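/- Let $r \ge 0$ and let $d_1,\dots,d_r$ be positive integers. Then there exists an integer $s=s(d_1,\dots,d_r) \ge 0$, depending only on $d_1,\dots,d_r$, with the following property. Let $k$ be any perfect field, let $n \ge 0$ be any integer, and let $f_1,\dots,f_r \in k[x_1,\dots,x_n]$ be homogeneous polynomials (with respect to the standard grading) with $f_i$ of degree $d_i$, where the zero polynomial counts as homogeneous of every degree. Then: (a) There exist an integer $t \le s$ and a regular sequence $g_1,\dots,g_t$ in $k[x_1,\dots,x_n]$, where each $g_j$ is homogeneous of degree at most $\max(d_1,\dots,d_r)$, such that $f_1,\dots,f_r$ all lie in the $k$-subalgebra $k[g_1,\dots,g_t]$ generated by $g_1,\dots,g_t$. (Here a regular sequence in a ring $R$ is a sequence such that each $g_j$ is a nonzerodivisor on $R/(g_1,\dots,g_{j-1})$ and $R/(g_1,\dots,g_t) \neq 0$; the empty sequence is allowed.) (b) The ideal $(f_1,\dots,f_r)$, as a $k[x_1,\dots,x_n]$-module, has projective dimension at most $s$. (The zero module has projective dimension $-\infty$.) -/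

import Mathlib

universe u

/-!
The proof is by contradiction and follows the ultraproduct method. If no bound existed for the
degrees `d`, there would be, for each `s : ℕ`, a perfect field `k s` and forms `f s i` of degrees
`d i` over `k s` which do not lie in a subalgebra generated by a regular sequence of at most `s`
forms of positive degree at most `max d`. Let `K` be the ultraproduct of the `k s`, and let `S m` be the
`K`-space of classes of families of forms of degree `m` in the ultraproduct of the polynomial rings.

*Polynomiality* (`aeval_injective`, `UltraPoly.aeval_injective`). The graded `K`-algebra `⨁ S m` is
a polynomial algebra on any minimal system of homogeneous generators. Families of translations of
the variables act on it by automorphisms which only add terms of lower degree, and a class of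
positive degree which they all fix vanishes. A homogeneous relation between the generators of
minimal degree is invariant under lifts of these automorphisms, hence so is its derivative with
respect to a generator of maximal weight, which must then be constant. So either the relation has a
linear term, contrary to the minimality of the generators, or all its derivatives vanish and, `K`
being perfect, it is the `p`-th power of a relation of lower degree, where `p` is the
characteristic.

*Transfer* (`UltraPoly.eventually_regularMod`). The classes of the families `f s i` are polynomials
in finitely many of these generators. Representatives of those generators are forms of degree at
most `max d`, which generate a subalgebra containing the `f s i` for almost all `s`. They form a
regular sequence for almost all `s`. Otherwise, one representative is a zero divisor modulo the
preceding ones for almost all `s`, and `exists_bounded_annihilator` provides annihilators of degree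
bounded independently of `s`, whose class would contradict the fact that distinct variables of a
polynomial ring form a regular sequence.

*Zero divisors of bounded degree* (`exists_bounded_annihilator`). Over an infinite field, a
homogeneous regular sequence of length `c` is completed by generic linear forms `l` to one of length
`n`, and the quotient by the completed sequence vanishes in degrees exceeding a bound independent of
`n` (`mem_partialIdeal_of_lengthBound_le`). Hence the quotient by the original sequence is generated
by boundedly many elements over the polynomials in `l`, and a form `h` satisfies an equation of
integral dependence of bounded degree over them. If one of minimal degree has zero constant term, it
yields an annihilator of `h` of bounded degree; if not, a nonzero polynomial in `l`, which is a
nonzerodivisor as `l` is regular, is a multiple of `h`. An arbitrary field is replaced by its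
algebraic closure, and annihilators descend by applying linear forms to their coefficients.

*Projective dimension* (`hasProjectiveDimensionLE_of_mem_adjoin`). A polynomial ring is free over
the polynomials in a homogeneous regular sequence `g` of forms of positive degree
(`exists_basis_mod`). The ideal generated by the `f i` is extended from an ideal of the polynomial
ring in the `t` variables `g`, whose projective dimension is at most `t` by Hilbert's syzygy
theorem.
-/

open MvPolynomial

/-! ### Rings with enough lowering endomorphisms -/

section Polynomiality

variable {K Q : Type u} [Field K] [CommRing Q] [Algebra K Q]

/-- The subspaces `S d` are the homogeneous pieces of a connected graded subalgebra `⨁ S d` of `Q`;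
nothing is required of the part of `Q` outside `⨁ S d`. -/
structure IsConnectedGrading (S : ℕ → Submodule K Q) : Prop where
  zero_le : S 0 ≤ 1
  one_mem : 1 ∈ S 0
  mul_mem : ∀ {a b : ℕ} {x y : Q}, x ∈ S a → y ∈ S b → x * y ∈ S (a + b)
  indep : ∀ (N : ℕ) (x : ℕ → Q), (∀ j, x j ∈ S j) → ∑ j ∈ Finset.range N, x j = 0 →
    ∀ j < N, x j = 0

/-- The elements of `⨁ S j` all of whose components have degree less than `d`. -/
def below (S : ℕ → Submodule K Q) (d : ℕ) : Submodule K Q := ⨆ j : Fin d, S j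

/-- The decomposable elements of degree `d`: sums of products of elements of positive degrees. -/
def decomposables (S : ℕ → Submodule K Q) (d : ℕ) : Submodule K Q :=
  ⨆ p : {p : ℕ × ℕ // p.1 + p.2 = d ∧ 0 < p.1 ∧ 0 < p.2}, S p.1.1 * S p.1.2

/-- A minimal system of homogeneous generators `v e`, of degrees `w e`, of `⨁ S d`. Minimality is
expressed by functionals dual to the generators which vanish on decomposables. -/
structure IsMinimalGenerators (S : ℕ → Submodule K Q) {E : Type u} (w : E → ℕ) (v : E → Q) :
    Prop where
  pos : ∀ e, 0 < w e
  mem : ∀ e, v e ∈ S (w e)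
  dual : ∀ e, ∃ l : Q →ₗ[K] K, l (v e) = 1 ∧ (∀ e', w e' = w e → e' ≠ e → l (v e') = 0) ∧
    ∀ x ∈ decomposables S (w e), l x = 0
  gen : ∀ d, 0 < d → S d ≤ Submodule.span K (v '' {e | w e = d}) ⊔ decomposables S d

/-- The degree `d` generators are lifted from a basis of `S d` modulo decomposables. -/
theorem exists_isMinimalGenerators (S : ℕ → Submodule K Q) :
    ∃ (E : Type u) (w : E → ℕ) (v : E → Q), IsMinimalGenerators S w v := by
  -- `b d` is a basis of the image of `S d` modulo decomposables, lifted to `S d` by `v`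
  let W : ∀ d : ℕ, Submodule K (Q ⧸ decomposables S d) := fun d =>
    (S d).map (decomposables S d).mkQ
  let b := fun d => Module.Basis.ofVectorSpace K (W d)
  have lift : ∀ e : Σ d : ℕ, Module.Basis.ofVectorSpaceIndex K (W (d + 1)),
      ∃ x ∈ S (e.1 + 1), (decomposables S (e.1 + 1)).mkQ x = b (e.1 + 1) e.2 :=
    fun e => Submodule.mem_map.1 (b (e.1 + 1) e.2).2
  choose v hvS hv using lift
  refine ⟨_, fun e => e.1 + 1, v, fun e => Nat.succ_pos _, hvS, ?_, ?_⟩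
  · rintro ⟨d, i⟩
    obtain ⟨g, hg⟩ := LinearMap.exists_extend ((b (d + 1)).coord i)
    have hgb : ∀ j, g (b (d + 1) j) = (b (d + 1)).coord i (b (d + 1) j) := fun j => by
      rw [← hg]; rfl
    refine ⟨g ∘ₗ (decomposables S (d + 1)).mkQ, ?_, ?_, ?_⟩
    · rw [LinearMap.comp_apply, hv ⟨d, i⟩, hgb]; simp
    · rintro ⟨d', j⟩ h1 h2
      obtain rfl : d' = d := by simpa using h1
      have hij : j ≠ i := fun h => h2 (by rw [h])
      rw [LinearMap.comp_apply, hv ⟨d', j⟩, hgb]; simp [hij]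
    · intro x hx
      rw [LinearMap.comp_apply, Submodule.mkQ_apply, (Submodule.Quotient.mk_eq_zero _).2 hx,
        map_zero]
  · rintro (_ | d) hd x hx
    · exact absurd hd (lt_irrefl _)
    have hxW : (decomposables S (d + 1)).mkQ x ∈ W (d + 1) := Submodule.mem_map_of_mem hx
    have h1 := (b (d + 1)).mem_span ⟨_, hxW⟩
    have h2 := Submodule.mem_map_of_mem (f := (W (d + 1)).subtype) h1
    rw [Submodule.map_span] at h2
    have h3 : Submodule.span K ((W (d + 1)).subtype '' Set.range (b (d + 1))) ≤
        (Submodule.span K (v '' {e | e.1 + 1 = d + 1})).map (decomposables S (d + 1)).mkQ := by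
      rw [Submodule.span_le]
      rintro _ ⟨_, ⟨i, rfl⟩, rfl⟩
      exact ⟨v ⟨d, i⟩, Submodule.subset_span ⟨_, rfl, rfl⟩, hv ⟨d, i⟩⟩
    obtain ⟨y, hy, hyx⟩ := h3 h2
    have h4 : x - y ∈ decomposables S (d + 1) := by
      rw [← Submodule.Quotient.mk_eq_zero, ← Submodule.mkQ_apply, map_sub, hyx]; simp
    rw [← add_sub_cancel y x]
    exact Submodule.add_mem_sup hy h4

section Monomials

variable {E : Type*} {w : E → ℕ}

/-- A property of polynomials indexed by degrees which is multiplicative and holds for the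
variables holds for all monomials. -/
theorem monomial_induction {P : ℕ → MvPolynomial E K → Prop} (one : P 0 1)
    (X_mem : ∀ e, P (w e) (X e)) (mul : ∀ {a b F G}, P a F → P b G → P (a + b) (F * G))
    (d : E →₀ ℕ) : P (Finsupp.weight w d) (monomial d 1) := by
  induction d using Finsupp.induction_linear with
  | zero => simpa using one
  | add f g hf hg => simpa [monomial_mul] using mul hf hg
  | single e n =>
    induction n with
    | zero => simpa using one
    | succ n ih =>
      have := mul ih (X_mem e)
      rw [X, monomial_mul, ← Finsupp.single_add, mul_one] at this
      convert this using 1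
      simp [Finsupp.weight_single]

/-- The polynomials all of whose monomials have weight less than `m`. -/
def weightLT (K : Type*) [Field K] (w : E → ℕ) (m : ℕ) : Submodule K (MvPolynomial E K) where
  carrier := {F | ∀ μ, coeff μ F ≠ 0 → Finsupp.weight w μ < m}
  zero_mem' := by simp
  add_mem' := fun {F G} hF hG μ h => by
    by_cases h1 : coeff μ F = 0
    · exact hG μ (by simpa [h1] using h)
    · exact hF μ h1
  smul_mem' := fun c F hF μ h => hF μ (by rw [coeff_smul] at h; exact right_ne_zero_of_smul h)

theorem mul_mem_weightLT {a b : ℕ} {F G : MvPolynomial E K}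
    (hF : ∀ μ, coeff μ F ≠ 0 → Finsupp.weight w μ ≤ a) (hG : G ∈ weightLT K w b) :
    F * G ∈ weightLT K w (a + b) := by
  classical
  intro μ h
  rw [coeff_mul] at h
  obtain ⟨⟨p, q⟩, hpq, hne⟩ := Finset.exists_ne_zero_of_sum_ne_zero h
  rw [Finset.HasAntidiagonal.mem_antidiagonal] at hpq
  have h1 := hF p (left_ne_zero_of_mul hne)
  have h2 := hG q (right_ne_zero_of_mul hne)
  rw [← hpq, map_add]
  exact add_lt_add_of_le_of_lt h1 h2

theorem eq_sum_of_mem_weightLT {m : ℕ} {F : MvPolynomial E K} (hF : F ∈ weightLT K w m) :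
    F = ∑ j ∈ Finset.range m, weightedHomogeneousComponent w j F := by
  classical
  ext μ
  simp only [coeff_sum, coeff_weightedHomogeneousComponent, Finset.sum_ite_eq, Finset.mem_range]
  split_ifs with h
  · rfl
  · by_contra h'
    exact h (hF μ h')

theorem mem_weightLT_of_isWeightedHomogeneous {m n : ℕ} {F : MvPolynomial E K}
    (hF : IsWeightedHomogeneous w F m) (h : m < n) : F ∈ weightLT K w n :=
  fun _ hμ => (hF hμ).trans_lt h

theorem pderiv_eq_zero_of_mem_weightLT {m : ℕ} {F : MvPolynomial E K} (hF : F ∈ weightLT K w m)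
    {e : E} (he : m ≤ w e) : pderiv e F = 0 := by
  ext μ
  rw [coeff_pderiv, coeff_zero]
  by_contra h
  have := hF _ (left_ne_zero_of_mul h)
  rw [map_add, Finsupp.weight_single] at this
  simp at this
  omega

/-- The chain rule. -/
theorem pderiv_aeval (g : E → MvPolynomial E K) (y : E) (F : MvPolynomial E K) :
    pderiv y (aeval g F) = ∑ z ∈ F.vars, aeval g (pderiv z F) * pderiv y (g z) := by
  classical
  have key : ∀ (s : Finset E), ∀ G ∈ supported K (s : Set E),
      pderiv y (aeval g G) = ∑ z ∈ s, aeval g (pderiv z G) * pderiv y (g z) := by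
    intro s G hG
    rw [supported_eq_adjoin_X] at hG
    induction hG using Algebra.adjoin_induction with
    | mem x hx =>
      obtain ⟨z, hz, rfl⟩ := hx
      rw [Finset.sum_eq_single z]
      · simp
      · intro b _ hb
        simp [pderiv_X_of_ne (Ne.symm hb)]
      · intro h; exact absurd hz h
    | algebraMap r => simp [MvPolynomial.algebraMap_eq]
    | add x y _ _ hx hy => simp only [map_add, hx, hy, add_mul, Finset.sum_add_distrib]
    | mul x y _ _ hx hy =>
      rw [map_mul, pderiv_mul, hx, hy, Finset.sum_mul, Finset.mul_sum, ← Finset.sum_add_distrib]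
      refine Finset.sum_congr rfl fun z _ => ?_
      rw [pderiv_mul, map_add, map_mul, map_mul]
      ring
  exact key F.vars F (mem_supported_vars F)

/-- If all partial derivatives of a nonconstant weighted homogeneous `F` vanish, then `F` is a
`p`-th power, provided that the coefficients have `p`-th roots. -/
theorem eq_zero_or_exists_pow_of_pderiv_eq_zero
    (hK : ∀ p : ℕ, p.Prime → CharP K p → ∀ c : K, ∃ b, b ^ p = c) {m : ℕ} (hm : 0 < m)
    {F : MvPolynomial E K} (hF : IsWeightedHomogeneous w F m) (h : ∀ e, pderiv e F = 0) :
    F = 0 ∨ ∃ m' < m, ∃ p, ∃ G : MvPolynomial E K, IsWeightedHomogeneous w G m' ∧ G ^ p = F := by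
  classical
  by_cases hF0 : F = 0
  · exact Or.inl hF0
  right
  obtain ⟨p, hp⟩ := CharP.exists K
  have hdvd : ∀ μ, coeff μ F ≠ 0 → ∀ e, p ∣ μ e := by
    intro μ hμ e
    by_cases h0 : μ e = 0
    · simp [h0]
    have h1 := congrArg (coeff (μ - Finsupp.single e 1)) (h e)
    have h2 : μ - Finsupp.single e 1 + Finsupp.single e 1 = μ :=
      tsub_add_cancel_of_le (by simpa using Nat.one_le_iff_ne_zero.2 h0)
    rw [coeff_pderiv, coeff_zero, h2] at h1
    have h3 := (mul_eq_zero.1 h1).resolve_left hμ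
    have h4 : (μ - Finsupp.single e 1 : E →₀ ℕ) e + 1 = μ e := by
      simp; omega
    rw [← CharP.cast_eq_zero_iff K p, ← h4]
    exact_mod_cast h3
  obtain ⟨μ, hμ⟩ := MvPolynomial.ne_zero_iff.1 hF0
  have hpp : p.Prime := by
    refine (CharP.char_is_prime_or_zero K p).resolve_right ?_
    rintro rfl
    have : μ = 0 := Finsupp.ext fun e => by simpa using hdvd μ hμ e
    have h1 := hF hμ
    rw [this, map_zero] at h1
    omega
  have : Fact p.Prime := ⟨hpp⟩
  choose root hroot using hK p hpp hp
  let dv : (E →₀ ℕ) → (E →₀ ℕ) := fun μ => μ.mapRange (· / p) (Nat.zero_div p)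
  have hdv : ∀ μ, coeff μ F ≠ 0 → p • dv μ = μ := fun μ hμ => Finsupp.ext fun e => by
    simpa [dv] using Nat.mul_div_cancel' (hdvd μ hμ e)
  have hw : ∀ μ, coeff μ F ≠ 0 → p * Finsupp.weight w (dv μ) = m := fun μ hμ => by
    rw [← smul_eq_mul, ← map_nsmul, hdv μ hμ, hF hμ]
  refine ⟨m / p, Nat.div_lt_self hm hpp.one_lt, p,
    ∑ μ ∈ F.support, monomial (dv μ) (root (coeff μ F)), ?_, ?_⟩
  · refine IsWeightedHomogeneous.sum _ _ _ fun μ hμ => isWeightedHomogeneous_monomial _ _ _ ?_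
    rw [← hw μ (mem_support_iff.1 hμ), Nat.mul_div_cancel_left _ hpp.pos]
  · rw [sum_pow_char]
    conv_rhs => rw [F.as_sum]
    refine Finset.sum_congr rfl fun μ hμ => ?_
    rw [monomial_pow, hroot, hdv μ (mem_support_iff.1 hμ)]

end Monomials

variable {S : ℕ → Submodule K Q} {E : Type u} {w : E → ℕ} {v : E → Q}

theorem aeval_mem (hS : IsConnectedGrading S) (hv : IsMinimalGenerators S w v) {m : ℕ}
    {F : MvPolynomial E K} (hF : IsWeightedHomogeneous w F m) : aeval v F ∈ S m := by
  have hmon := monomial_induction (K := K) (w := w) (P := fun m F => aeval v F ∈ S m)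
    (by simpa using hS.one_mem) (fun e => by simpa using hv.mem e)
    (fun h1 h2 => by simpa using hS.mul_mem h1 h2)
  induction hF using IsWeightedHomogeneous.induction_on with
  | zero => simp
  | add p q _ _ hp hq => rw [map_add]; exact add_mem hp hq
  | monomial d r hr =>
    rw [← mul_one r, ← smul_eq_mul, ← smul_monomial, map_smul]
    exact (S m).smul_mem _ (hr ▸ hmon d)

theorem exists_aeval_eq (hS : IsConnectedGrading S) (hv : IsMinimalGenerators S w v) (m : ℕ) :
    ∀ x ∈ S m, ∃ F : MvPolynomial E K, IsWeightedHomogeneous w F m ∧ aeval v F = x := by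
  suffices h : S m ≤ (weightedHomogeneousSubmodule K w m).map (aeval v).toLinearMap from
    fun x hx => h hx
  induction m using Nat.strong_induction_on with
  | _ m ih =>
  rcases Nat.eq_zero_or_pos m with rfl | hm
  · intro x hx
    obtain ⟨c, rfl⟩ := Submodule.mem_one.1 (hS.zero_le hx)
    exact ⟨C c, isWeightedHomogeneous_C w c, by simp⟩
  refine (hv.gen m hm).trans (sup_le ?_ (iSup_le ?_))
  · rw [Submodule.span_le]
    rintro _ ⟨e, rfl, rfl⟩
    exact ⟨X e, isWeightedHomogeneous_X K w e, by simp⟩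
  · rintro ⟨⟨a, b⟩, hab, ha, hb⟩
    simp only at hab ha hb
    rw [Submodule.mul_le]
    intro x hx y hy
    obtain ⟨F, hF, rfl⟩ := ih a (by omega) hx
    obtain ⟨G, hG, rfl⟩ := ih b (by omega) hy
    exact ⟨F * G, hab ▸ IsWeightedHomogeneous.mul hF hG, by simp⟩

/-- There is no linear relation among minimal generators modulo decomposables. -/
theorem coeff_single_eq_zero (hS : IsConnectedGrading S) (hv : IsMinimalGenerators S w v) {e : E}
    {F : MvPolynomial E K} (hF : IsWeightedHomogeneous w F (w e)) (h0 : aeval v F = 0) :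
    coeff (Finsupp.single e 1) F = 0 := by
  classical
  obtain ⟨l, hl1, hl2, hl3⟩ := hv.dual e
  suffices h : l (aeval v F) = coeff (Finsupp.single e 1) F by rw [← h, h0, map_zero]
  clear h0
  induction hF using IsWeightedHomogeneous.induction_on with
  | zero => simp
  | add p q _ _ hp hq => simp [hp, hq]
  | monomial d r hr =>
    have hd : d ≠ 0 := by
      rintro rfl
      have := hv.pos e
      simp at hr; omega
    obtain ⟨e', he'⟩ := Finsupp.ne_iff.1 hd
    have hsplit : Finsupp.single e' 1 + (d - Finsupp.single e' 1) = d :=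
      add_tsub_cancel_of_le (by simpa using Nat.one_le_iff_ne_zero.2 he')
    set d' := d - Finsupp.single e' 1 with hd'
    have hval : aeval v (monomial d r) = v e' * aeval v (monomial d' r) := by
      rw [← hsplit, ← one_mul r, ← monomial_mul, map_mul]
      simp [aeval_monomial]
    have hw : w e' + Finsupp.weight w d' = w e := by
      rw [← hr, ← hsplit, map_add, Finsupp.weight_single]; simp
    rcases eq_or_ne d' 0 with h | h
    · rw [h] at hsplit hval hw
      rw [← hsplit, add_zero, coeff_monomial]
      rw [← hsplit, add_zero] at hval
      have hv' : aeval v (monomial (Finsupp.single e' 1) r) = r • v e' := by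
        rw [hval, monomial_zero', aeval_C, Algebra.smul_def, mul_comm]
      rw [hv', map_smul]
      split_ifs with h1
      · obtain rfl := Finsupp.single_left_injective one_ne_zero h1
        rw [hl1, smul_eq_mul, mul_one]
      · rw [hl2 e' (by simpa using hw) (fun h => h1 (by rw [h])), smul_zero]
    · have hpos : 0 < Finsupp.weight w d' := by
        obtain ⟨f, hf⟩ := Finsupp.ne_iff.1 h
        exact (hv.pos f).trans_le (Finsupp.le_weight_of_ne_zero' w (f := d') (by simpa using hf))
      have hne : d ≠ Finsupp.single e 1 := by
        intro hde
        have h1 : e' = e := by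
          by_contra hne
          apply he'
          rw [hde]
          simp [Ne.symm hne]
        apply h
        rw [hd', hde, h1, tsub_self]
      rw [coeff_monomial, if_neg hne]
      refine hl3 _ (Submodule.mem_iSup_of_mem ⟨(w e', Finsupp.weight w d'), hw, hv.pos e', hpos⟩ ?_)
      rw [hval]
      exact Submodule.mul_mem_mul (hv.mem e')
        (aeval_mem hS hv (isWeightedHomogeneous_monomial w d' r rfl))

theorem below_le_map (hS : IsConnectedGrading S) (hv : IsMinimalGenerators S w v) (m : ℕ) :
    below S m ≤ (weightLT K w m).map (aeval v).toLinearMap := by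
  refine iSup_le fun j x hx => ?_
  obtain ⟨F, hF, rfl⟩ := exists_aeval_eq hS hv j x hx
  exact ⟨F, mem_weightLT_of_isWeightedHomogeneous hF j.2, rfl⟩

/-- An endomorphism which only adds terms of lower degree lifts to such an endomorphism of the
polynomial ring on the generators. -/
theorem exists_lift (hS : IsConnectedGrading S) (hv : IsMinimalGenerators S w v) (τ : Q →ₐ[K] Q)
    (hτ : ∀ d, ∀ x ∈ S d, τ x - x ∈ below S d) :
    ∃ g : E → MvPolynomial E K, (∀ e, g e - X e ∈ weightLT K w (w e)) ∧
      (∀ F : MvPolynomial E K, aeval v (aeval g F) = τ (aeval v F)) ∧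
      ∀ (m : ℕ) (F : MvPolynomial E K), IsWeightedHomogeneous w F m →
        aeval g F - F ∈ weightLT K w m := by
  have h1 : ∀ e, ∃ G : MvPolynomial E K, G ∈ weightLT K w (w e) ∧
      aeval v G = τ (v e) - v e := fun e => below_le_map hS hv _ (hτ _ _ (hv.mem e))
  choose δ hδ hδ' using h1
  have hg : ∀ e, X e + δ e - X e ∈ weightLT K w (w e) := fun e => by simpa using hδ e
  refine ⟨fun e => X e + δ e, hg, fun F => ?_, fun m F hF => ?_⟩
  · have : (aeval v).comp (aeval fun e => X e + δ e) = τ.comp (aeval v) := by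
      ext e; simp [hδ']
    exact DFunLike.congr_fun this F
  · have hmon := monomial_induction (K := K) (w := w)
      (P := fun m F => (∀ μ, coeff μ F ≠ 0 → Finsupp.weight w μ ≤ m) ∧
        aeval (fun e => X e + δ e) F - F ∈ weightLT K w m)
      ⟨fun μ hμ => (isWeightedHomogeneous_one K w hμ).le, by simp⟩
      (fun e => ⟨fun μ hμ => (isWeightedHomogeneous_X K w e hμ).le, by simpa using hδ e⟩)
      (fun {a b F G} hF hG => by
        have hle : ∀ {c H}, H ∈ weightLT K w c → ∀ μ, coeff μ H ≠ 0 → Finsupp.weight w μ ≤ c :=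
          fun hH μ hμ => (hH μ hμ).le
        constructor
        · classical
          intro μ h
          rw [coeff_mul] at h
          obtain ⟨⟨p, q⟩, hpq, hne⟩ := Finset.exists_ne_zero_of_sum_ne_zero h
          rw [Finset.HasAntidiagonal.mem_antidiagonal] at hpq
          rw [← hpq, map_add]
          exact add_le_add (hF.1 p (left_ne_zero_of_mul hne)) (hG.1 q (right_ne_zero_of_mul hne))
        · set τF := aeval (fun e => X e + δ e) F
          set τG := aeval (fun e => X e + δ e) G
          have : aeval (fun e => X e + δ e) (F * G) - F * G =
              F * (τG - G) + (G * (τF - F) + (τF - F) * (τG - G)) := by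
            rw [map_mul]; ring
          rw [this]
          refine add_mem (mul_mem_weightLT hF.1 hG.2) (add_mem ?_ ?_)
          · rw [add_comm a b]; exact mul_mem_weightLT hG.1 hF.2
          · exact mul_mem_weightLT (hle hF.2) hG.2)
    induction hF using IsWeightedHomogeneous.induction_on with
    | zero => simp
    | add p q _ _ hp hq => rw [map_add, add_sub_add_comm]; exact add_mem hp hq
    | monomial d r hr =>
      rw [← mul_one r, ← smul_eq_mul, ← smul_monomial, map_smul, ← smul_sub]
      exact Submodule.smul_mem _ _ (hr ▸ (hmon d).2)

/-- Injectivity in degree `m` follows from injectivity in lower degrees. Lowering endomorphisms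
fix a relation `F` of minimal degree, hence also its derivative by a variable of maximal degree;
this derivative is therefore constant, and `F` has a linear term. -/
theorem eq_zero_of_aeval_eq_zero [IsReduced Q] [Nontrivial Q]
    (hK : ∀ p : ℕ, p.Prime → CharP K p → ∀ c : K, ∃ b, b ^ p = c)
    (hS : IsConnectedGrading S) (hv : IsMinimalGenerators S w v) (T : Set (Q →ₐ[K] Q))
    (hT : ∀ τ ∈ T, ∀ d, ∀ x ∈ S d, τ x - x ∈ below S d)
    (hsep : ∀ d, 0 < d → ∀ x ∈ S d, (∀ τ ∈ T, τ x = x) → x = 0) (m : ℕ) :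
    ∀ F : MvPolynomial E K, IsWeightedHomogeneous w F m → aeval v F = 0 → F = 0 := by
  classical
  induction m using Nat.strong_induction_on with
  | _ m ih =>
  intro F hF hF0
  by_contra hne
  have inj : ∀ G ∈ weightLT K w m, aeval v G = 0 → G = 0 := by
    intro G hG hG0
    have hcomp : ∀ j, IsWeightedHomogeneous w (weightedHomogeneousComponent w j G) j := fun j =>
      weightedHomogeneousComponent_isWeightedHomogeneous j G
    rw [eq_sum_of_mem_weightLT hG, map_sum] at hG0
    have := hS.indep m (fun j => aeval v (weightedHomogeneousComponent w j G))
      (fun j => aeval_mem hS hv (hcomp j)) hG0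
    rw [eq_sum_of_mem_weightLT hG]
    exact Finset.sum_eq_zero fun j hj => ih j (Finset.mem_range.1 hj) _ (hcomp j)
      (this j (Finset.mem_range.1 hj))
  have const : ∀ {G : MvPolynomial E K}, IsWeightedHomogeneous w G 0 → G = C (coeff 0 G) := by
    intro G hG
    ext μ
    rw [coeff_C]
    split_ifs with h
    · rw [h]
    · by_contra h'
      obtain ⟨f, hf⟩ := Finsupp.ne_iff.1 (Ne.symm h)
      have h1 := Finsupp.le_weight_of_ne_zero' w (f := μ) (by simpa using hf)
      have h2 := hv.pos f
      have h3 := hG h'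
      omega
  rcases Nat.eq_zero_or_pos m with rfl | hm
  · rw [const hF, aeval_C, map_eq_zero_iff _ (algebraMap K Q).injective] at hF0
    exact hne (by rw [const hF, hF0, C_0])
  by_cases hder : ∀ e, pderiv e F = 0
  · obtain h | ⟨m', hm', p, G, hG, rfl⟩ := eq_zero_or_exists_pow_of_pderiv_eq_zero hK hm hF hder
    · exact hne h
    · rw [map_pow] at hF0
      have hp : p ≠ 0 := by rintro rfl; simp at hF0
      rw [ih m' hm' G hG (eq_zero_of_pow_eq_zero hF0), zero_pow hp] at hne
      exact hne rfl
  push Not at hder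
  -- a variable of maximal weight among those on which `F` depends separably
  have hfin : {e | pderiv e F ≠ 0}.Finite := F.vars.finite_toSet.subset fun e he => by
    by_contra h
    exact he (pderiv_eq_zero_of_notMem_vars h)
  obtain ⟨y, hy, hmax⟩ := hfin.exists_maximalFor w _ hder
  have hmax' : ∀ z, pderiv z F ≠ 0 → w z ≤ w y := fun z hz => by
    by_contra h
    push Not at h
    exact absurd (hmax hz h.le) (not_le.2 h)
  have hyF : w y ≤ m := by
    obtain ⟨μ, hμ⟩ := MvPolynomial.ne_zero_iff.1 hy
    rw [coeff_pderiv] at hμ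
    have := hF (left_ne_zero_of_mul hμ)
    rw [map_add, Finsupp.weight_single] at this
    simp at this
    omega
  have hyh : IsWeightedHomogeneous w (pderiv y F) (m - w y) := hF.pderiv (by omega)
  have hypos := hv.pos y
  have hfix : ∀ τ ∈ T, τ (aeval v (pderiv y F)) = aeval v (pderiv y F) := by
    intro τ hτ
    obtain ⟨g, hg, hgτ, hglow⟩ := exists_lift hS hv τ (hT τ hτ)
    have hgF : aeval g F = F := by
      rw [← sub_eq_zero]
      exact inj _ (hglow m F hF) (by rw [map_sub, hgτ, hF0]; simp)
    have hchain := pderiv_aeval g y F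
    have hz : ∀ z, pderiv z F ≠ 0 → pderiv y (g z) = pderiv y (X z) := fun z hz => by
      rw [← sub_eq_zero, ← map_sub]
      exact pderiv_eq_zero_of_mem_weightLT (hg z) (hmax' z hz)
    rw [hgF, Finset.sum_eq_single y] at hchain
    · rw [hz y hy, pderiv_X_self, mul_one] at hchain
      rw [← hgτ, ← hchain]
    · intro z _ hzy
      by_cases h : pderiv z F = 0
      · simp [h]
      · rw [hz z h, pderiv_X_of_ne hzy, mul_zero]
    · intro h
      exact absurd (pderiv_eq_zero_of_notMem_vars h) hy
  have hm' : m - w y = 0 := by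
    by_contra h
    have h1 := hsep _ (Nat.pos_of_ne_zero h) _ (aeval_mem hS hv hyh) hfix
    exact hy (ih _ (by omega) _ hyh h1)
  have hmy : m = w y := by omega
  subst hmy
  have hlin := coeff_single_eq_zero hS hv hF hF0
  apply hy
  rw [hm'] at hyh
  rw [const hyh, coeff_pderiv, zero_add, hlin]
  simp

/-- Minimal homogeneous generators of a connected graded algebra with enough lowering
endomorphisms are algebraically independent. -/
theorem aeval_injective [IsReduced Q] [Nontrivial Q]
    (hK : ∀ p : ℕ, p.Prime → CharP K p → ∀ c : K, ∃ b, b ^ p = c)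
    (hS : IsConnectedGrading S) (hv : IsMinimalGenerators S w v) (T : Set (Q →ₐ[K] Q))
    (hT : ∀ τ ∈ T, ∀ d, ∀ x ∈ S d, τ x - x ∈ below S d)
    (hsep : ∀ d, 0 < d → ∀ x ∈ S d, (∀ τ ∈ T, τ x = x) → x = 0) :
    Function.Injective (aeval v : MvPolynomial E K →ₐ[K] Q) := by
  rw [injective_iff_map_eq_zero]
  intro G hG0
  have hG : G ∈ weightLT K w (weightedTotalDegree w G + 1) := fun μ hμ =>
    Nat.lt_succ_of_le (le_weightedTotalDegree w (mem_support_iff.2 hμ))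
  have hcomp : ∀ j, IsWeightedHomogeneous w (weightedHomogeneousComponent w j G) j := fun j =>
    weightedHomogeneousComponent_isWeightedHomogeneous j G
  rw [eq_sum_of_mem_weightLT hG, map_sum] at hG0
  have := hS.indep _ (fun j => aeval v (weightedHomogeneousComponent w j G))
    (fun j => aeval_mem hS hv (hcomp j)) hG0
  rw [eq_sum_of_mem_weightLT hG]
  exact Finset.sum_eq_zero fun j hj => eq_zero_of_aeval_eq_zero hK hS hv T hT hsep j _ (hcomp j)
    (this j (Finset.mem_range.1 hj))

end Polynomiality

/-! ### Regular sequences modulo an ideal and generic linear forms -/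

section RegularMod

variable {R : Type*} [CommRing R]

/-- `a` is a nonzerodivisor on `R ⧸ I`. -/
def NonZeroDivisorMod (I : Ideal R) (a : R) : Prop := ∀ u, a * u ∈ I → u ∈ I

/-- The ideal generated by `I` and the first `j` terms of the sequence `G`. -/
def partialIdeal (I : Ideal R) (G : ℕ → R) (j : ℕ) : Ideal R := I ⊔ Ideal.span (G '' Set.Iio j)

/-- The first `c` terms of `G` form a weakly regular sequence on `R ⧸ I`. -/
def RegularMod (I : Ideal R) (G : ℕ → R) (c : ℕ) : Prop :=
  ∀ j < c, NonZeroDivisorMod (partialIdeal I G j) (G j)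

variable {I J : Ideal R} {G : ℕ → R}

theorem partialIdeal_zero : partialIdeal I G 0 = I := by simp [partialIdeal]

theorem partialIdeal_succ (j : ℕ) :
    partialIdeal I G (j + 1) = partialIdeal I G j ⊔ Ideal.span {G j} := by
  rw [partialIdeal, partialIdeal, sup_assoc, ← Ideal.span_union, ← Set.image_singleton,
    ← Set.image_union]
  congr 3
  ext i
  simp

theorem partialIdeal_sup (j : ℕ) : partialIdeal (I ⊔ J) G j = partialIdeal I G j ⊔ J := by
  rw [partialIdeal, partialIdeal, sup_right_comm]

theorem le_partialIdeal (j : ℕ) : I ≤ partialIdeal I G j := le_sup_left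

theorem mem_partialIdeal {i j : ℕ} (h : i < j) : G i ∈ partialIdeal I G j :=
  Ideal.mem_sup_right (Ideal.subset_span ⟨i, h, rfl⟩)

theorem RegularMod.mono {c c' : ℕ} (h : RegularMod I G c) (hc : c' ≤ c) : RegularMod I G c' :=
  fun j hj => h j (hj.trans_le hc)

/-- The two terms of a regular sequence `a, l` modulo `I` are exchanged; only the regularity of the
new second term is asserted. -/
theorem NonZeroDivisorMod.swap {a l : R} (ha : NonZeroDivisorMod I a)
    (hl : NonZeroDivisorMod (I ⊔ Ideal.span {a}) l) :
    NonZeroDivisorMod (I ⊔ Ideal.span {l}) a := by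
  intro u hu
  obtain ⟨i, hi, v, huv⟩ := Submodule.mem_sup.1 hu
  obtain ⟨hv, huv⟩ := huv
  obtain ⟨v, rfl⟩ := Ideal.mem_span_singleton.1 hv
  have h1 : v ∈ I ⊔ Ideal.span {a} := by
    refine hl v ?_
    have : l * v = -i + a * u := by rw [← huv]; ring
    rw [this]
    exact add_mem (Ideal.mem_sup_left (neg_mem hi))
      (Ideal.mem_sup_right (Ideal.mul_mem_right _ _ (Ideal.mem_span_singleton_self a)))
  obtain ⟨i', hi', x, hx, rfl⟩ := Submodule.mem_sup.1 h1
  obtain ⟨w, rfl⟩ := Ideal.mem_span_singleton.1 hx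
  have h2 : u - l * w ∈ I := by
    refine ha _ ?_
    have : a * (u - l * w) = i + l * i' := by linear_combination -huv
    rw [this]
    exact add_mem hi (Ideal.mul_mem_left _ _ hi')
  have : u = (u - l * w) + l * w := by ring
  rw [this]
  exact add_mem (Ideal.mem_sup_left h2)
    (Ideal.mem_sup_right (Ideal.mul_mem_right _ _ (Ideal.mem_span_singleton_self l)))

theorem RegularMod.sup_span_singleton {c : ℕ} {l : R} (h : RegularMod I G c)
    (hl : ∀ j ≤ c, NonZeroDivisorMod (partialIdeal I G j) l) :
    RegularMod (I ⊔ Ideal.span {l}) G c := by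
  intro j hj
  rw [partialIdeal_sup]
  refine (h j hj).swap ?_
  rw [← partialIdeal_succ]
  exact hl (j + 1) hj

/-- No nonzero element of `R ⧸ I` is killed by all the elements `x i`. -/
def SocleFree {ι : Type*} (x : ι → R) (I : Ideal R) : Prop := ∀ u, (∀ i, x i * u ∈ I) → u ∈ I

/-- If `a` and `l` are nonzerodivisors modulo `I`, then the socles of `R ⧸ (I, a)` and
`R ⧸ (I, l)` are isomorphic: `u` corresponds to `v` when `l * u = a * v` modulo `I`. -/
theorem SocleFree.exchange {ι : Type*} {x : ι → R} {a l : R} (ha : NonZeroDivisorMod I a)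
    (hl : NonZeroDivisorMod I l) (hx : l ∈ Ideal.span (Set.range x))
    (h : SocleFree x (I ⊔ Ideal.span {l})) : SocleFree x (I ⊔ Ideal.span {a}) := by
  intro u hu
  have hlu : l * u ∈ I ⊔ Ideal.span {a} := by
    have : Ideal.span (Set.range x) ≤ (I ⊔ Ideal.span {a}).colon {u} := by
      rw [Ideal.span_le]
      rintro _ ⟨i, rfl⟩
      simpa [Submodule.mem_colon_singleton] using hu i
    simpa [Submodule.mem_colon_singleton] using this hx
  obtain ⟨c, hc, y, hy, hcy⟩ := Submodule.mem_sup.1 hlu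
  obtain ⟨v, rfl⟩ := Ideal.mem_span_singleton.1 hy
  have hv : v ∈ I ⊔ Ideal.span {l} := by
    refine h v fun i => ?_
    obtain ⟨ci, hci, z, hz, hcz⟩ := Submodule.mem_sup.1 (hu i)
    obtain ⟨wi, rfl⟩ := Ideal.mem_span_singleton.1 hz
    have h1 : x i * v - l * wi ∈ I := by
      refine ha _ ?_
      have : a * (x i * v - l * wi) = l * ci - x i * c := by
        linear_combination x i * hcy - l * hcz
      rw [this]
      exact sub_mem (Ideal.mul_mem_left _ _ hci) (Ideal.mul_mem_left _ _ hc)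
    have : x i * v = (x i * v - l * wi) + l * wi := by ring
    rw [this]
    exact add_mem (Ideal.mem_sup_left h1)
      (Ideal.mem_sup_right (Ideal.mul_mem_right _ _ (Ideal.mem_span_singleton_self l)))
  obtain ⟨c', hc', z, hz, rfl⟩ := Submodule.mem_sup.1 hv
  obtain ⟨v', rfl⟩ := Ideal.mem_span_singleton.1 hz
  have h2 : u - a * v' ∈ I := by
    refine hl _ ?_
    have : l * (u - a * v') = c + a * c' := by linear_combination -hcy
    rw [this]
    exact add_mem hc (Ideal.mul_mem_left _ _ hc')
  have : u = (u - a * v') + a * v' := by ring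
  rw [this]
  exact add_mem (Ideal.mem_sup_left h2)
    (Ideal.mem_sup_right (Ideal.mul_mem_right _ _ (Ideal.mem_span_singleton_self a)))

end RegularMod

section LinearForms

variable {k : Type*} [Field k] {n : ℕ}

/-- The linear form with the given coefficients. -/
noncomputable def linearForm (k : Type*) [Field k] (n : ℕ) :
    (Fin n → k) →ₗ[k] MvPolynomial (Fin n) k :=
  Fintype.linearCombination k (X : Fin n → MvPolynomial (Fin n) k)

theorem linearForm_single (i : Fin n) : linearForm k n (Pi.single i 1) = X i := by
  classical
  simp [linearForm, Fintype.linearCombination_apply_single]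

theorem linearForm_isHomogeneous (a : Fin n → k) : (linearForm k n a).IsHomogeneous 1 := by
  rw [linearForm, Fintype.linearCombination_apply]
  exact IsHomogeneous.sum _ _ _ fun i _ =>
    (homogeneousSubmodule (Fin n) k 1).smul_mem _ (isHomogeneous_X k i)

theorem linearForm_mem_span (a : Fin n → k) :
    linearForm k n a ∈ Ideal.span (Set.range (X : Fin n → MvPolynomial (Fin n) k)) := by
  rw [linearForm, Fintype.linearCombination_apply]
  refine sum_mem fun i _ => ?_
  rw [Algebra.smul_def]
  exact Ideal.mul_mem_left _ _ (Ideal.subset_span ⟨i, rfl⟩)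

theorem coeff_linearForm (a : Fin n → k) (i : Fin n) :
    coeff (Finsupp.single i 1) (linearForm k n a) = a i := by
  classical
  simp [linearForm, Fintype.linearCombination_apply, coeff_sum, coeff_smul, coeff_X,
    Finsupp.single_left_inj]

theorem linearForm_injective : Function.Injective (linearForm k n) := fun a b h =>
  funext fun i => by rw [← coeff_linearForm a, h, coeff_linearForm]

/-- The ideal generated by a space of linear forms. -/
noncomputable def linearIdeal (Λ : Submodule k (Fin n → k)) : Ideal (MvPolynomial (Fin n) k) :=
  Ideal.span (linearForm k n '' Λ)

theorem linearIdeal_sup_span (Λ : Submodule k (Fin n → k)) (a : Fin n → k) :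
    linearIdeal (Λ ⊔ Submodule.span k {a}) = linearIdeal Λ ⊔ Ideal.span {linearForm k n a} := by
  apply le_antisymm
  · rw [linearIdeal, Ideal.span_le]
    rintro _ ⟨b, hb, rfl⟩
    obtain ⟨c, hc, x, hx, rfl⟩ := Submodule.mem_sup.1 hb
    obtain ⟨r, rfl⟩ := Submodule.mem_span_singleton.1 hx
    rw [map_add, map_smul, Algebra.smul_def]
    exact add_mem (Ideal.mem_sup_left (Ideal.subset_span ⟨c, hc, rfl⟩))
      (Ideal.mem_sup_right (Ideal.mul_mem_left _ _ (Ideal.mem_span_singleton_self _)))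
  · refine sup_le (Ideal.span_mono (Set.image_mono ?_)) ?_
    · exact SetLike.coe_subset_coe.2 le_sup_left
    · rw [Ideal.span_singleton_le_iff_mem]
      exact Ideal.subset_span
        ⟨a, Submodule.mem_sup_right (Submodule.mem_span_singleton_self a), rfl⟩

/-- Modulo fewer than `n` linear forms, the socle vanishes: projecting the space of linear forms
along `Λ` identifies the quotient with a subring of the polynomial ring. -/
theorem socleFree_linearIdeal {Λ : Submodule k (Fin n → k)} (h : Λ ≠ ⊤) :
    SocleFree X (linearIdeal Λ) := by
  obtain ⟨Λ', hΛ⟩ := Λ.exists_isCompl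
  let π : (Fin n → k) →ₗ[k] (Fin n → k) := Λ.projection Λ' hΛ
  have hπ : ∀ a ∈ Λ, π a = a := fun a ha => Submodule.projection_apply_of_mem_left hΛ ha
  have hπm : ∀ a, π a ∈ Λ := fun a => Submodule.projection_apply_mem hΛ a
  let φ : MvPolynomial (Fin n) k →ₐ[k] MvPolynomial (Fin n) k :=
    aeval fun i => linearForm k n (Pi.single i 1 - π (Pi.single i 1))
  have hφlin : ∀ a, φ (linearForm k n a) = linearForm k n (a - π a) := by
    intro a
    have : φ.toLinearMap ∘ₗ linearForm k n = linearForm k n ∘ₗ (LinearMap.id - π) := by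
      refine (Pi.basisFun k (Fin n)).ext fun i => ?_
      simp only [Pi.basisFun_apply, LinearMap.comp_apply, linearForm_single,
        AlgHom.toLinearMap_apply, LinearMap.sub_apply, LinearMap.id_apply]
      simp [φ]
    exact LinearMap.congr_fun this a
  have hφmem : ∀ f, f - φ f ∈ linearIdeal Λ := by
    intro f
    have : (Ideal.Quotient.mkₐ k (linearIdeal Λ)) =
        (Ideal.Quotient.mkₐ k (linearIdeal Λ)).comp φ := by
      ext i
      simp only [AlgHom.comp_apply, φ, aeval_X, Ideal.Quotient.mkₐ_eq_mk]
      rw [Ideal.Quotient.eq, ← linearForm_single, ← map_sub, sub_sub_cancel]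
      exact Ideal.subset_span ⟨_, hπm _, rfl⟩
    rw [← Ideal.Quotient.eq]
    exact DFunLike.congr_fun this f
  have hφzero : ∀ f ∈ linearIdeal Λ, φ f = 0 := by
    have : linearIdeal Λ ≤ RingHom.ker φ := by
      rw [linearIdeal, Ideal.span_le]
      rintro _ ⟨a, ha, rfl⟩
      rw [SetLike.mem_coe, RingHom.mem_ker, hφlin, hπ a ha, sub_self, map_zero]
    exact this
  intro u hu
  obtain ⟨i, hi⟩ : ∃ i, φ (X i) ≠ 0 := by
    by_contra! hall
    apply h
    rw [eq_top_iff, ← (Pi.basisFun k (Fin n)).span_eq, Submodule.span_le]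
    rintro _ ⟨i, rfl⟩
    have h1 := hall i
    rw [← linearForm_single, hφlin, map_eq_zero_iff _ linearForm_injective, sub_eq_zero] at h1
    rw [Pi.basisFun_apply, h1]
    exact hπm _
  have h1 := hφzero _ (hu i)
  rw [map_mul, mul_eq_zero] at h1
  have h2 := hφmem u
  rwa [h1.resolve_left hi, sub_zero] at h2

/-- Over an infinite field, a generic linear form is a nonzerodivisor modulo finitely many ideals
with vanishing socle: none of their associated primes contains all linear forms. -/
theorem exists_linearForm_nonZeroDivisorMod [Infinite k] {ι : Type*} [Finite ι]
    (I : ι → Ideal (MvPolynomial (Fin n) k)) (hI : ∀ j, SocleFree X (I j)) :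
    ∃ a, ∀ j, NonZeroDivisorMod (I j) (linearForm k n a) := by
  let R := MvPolynomial (Fin n) k
  have hfin : ∀ j, Finite (associatedPrimes R (R ⧸ I j)) := fun j =>
    (associatedPrimes.finite R (R ⧸ I j)).to_subtype
  let P : (Σ j, associatedPrimes R (R ⧸ I j)) → Subspace k (Fin n → k) := fun q =>
    (Submodule.restrictScalars k q.2.1).comap (linearForm k n)
  have hP : ⋃ q, (P q : Set (Fin n → k)) ≠ Set.univ := by
    intro hcov
    obtain ⟨⟨j, p, hp⟩, htop⟩ := Subspace.exists_eq_top_of_iUnion_eq_univ hcov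
    obtain ⟨hprime, x, hx⟩ := isAssociatedPrime_iff.1 (AssociatedPrimes.mem_iff.1 hp)
    obtain ⟨u, rfl⟩ := Ideal.Quotient.mk_surjective x
    have hX : ∀ i, X i ∈ p := fun i => by
      have : Pi.single i 1 ∈ P ⟨j, p, hp⟩ := by rw [htop]; trivial
      rw [← linearForm_single]
      exact this
    have hu : u ∈ I j := hI j u fun i => by
      have := hX i
      rw [hx, Submodule.mem_colon_singleton, Submodule.mem_bot, ← Ideal.Quotient.mk_eq_mk,
        ← Submodule.Quotient.mk_smul, Submodule.Quotient.mk_eq_zero] at this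
      exact this
    apply hprime.ne_top
    rw [hx, Ideal.eq_top_iff_one, Submodule.mem_colon_singleton, one_smul, Submodule.mem_bot,
      Ideal.Quotient.eq_zero_iff_mem]
    exact hu
  obtain ⟨a, ha⟩ := (Set.ne_univ_iff_exists_notMem _).1 hP
  refine ⟨a, fun j u hu => ?_⟩
  have h1 : linearForm k n a ∉ ⋃ p ∈ associatedPrimes R (R ⧸ I j), (p : Set R) := by
    intro h
    obtain ⟨p, hp, hap⟩ := Set.mem_iUnion₂.1 h
    exact ha (Set.mem_iUnion.2 ⟨⟨j, p, hp⟩, hap⟩)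
  rw [biUnion_associatedPrimes_eq_zero_divisors] at h1
  by_contra hne
  refine h1 ⟨Ideal.Quotient.mk _ u, fun h => hne (Ideal.Quotient.eq_zero_iff_mem.1 h), ?_⟩
  rw [← Ideal.Quotient.mk_eq_mk, ← Submodule.Quotient.mk_smul, Submodule.Quotient.mk_eq_zero]
  exact hu

theorem finrank_sup_span_singleton_le (Λ : Submodule k (Fin n → k)) (a : Fin n → k) :
    Module.finrank k ↥(Λ ⊔ Submodule.span k {a}) ≤ Module.finrank k Λ + 1 :=
  (Submodule.finrank_add_le_finrank_add_finrank _ _).trans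
    (Nat.add_le_add_left ((finrank_span_le_card {a}).trans (by simp)) _)

/-- A regular sequence, together with linear forms, of total length less than the number `n` of
variables leaves a quotient with vanishing socle (that is, of positive depth). A generic linear
form is exchanged for the last term of the sequence until only linear forms remain. -/
theorem socleFree_of_regularMod [Infinite k] (c : ℕ) :
    ∀ (Λ : Submodule k (Fin n → k)) (G : ℕ → MvPolynomial (Fin n) k),
      Module.finrank k Λ + c < n → RegularMod (linearIdeal Λ) G c →
      SocleFree X (partialIdeal (linearIdeal Λ) G c) := by
  induction c using Nat.strong_induction_on with
  | _ c ih =>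
  intro Λ G hc hG
  rcases c with _ | c
  · rw [partialIdeal_zero]
    refine socleFree_linearIdeal ?_
    rintro rfl
    simp at hc
  obtain ⟨a, ha⟩ := exists_linearForm_nonZeroDivisorMod
    (fun j : Fin (c + 1) => partialIdeal (linearIdeal Λ) G j)
    (fun j => ih j j.2 Λ G (by omega) (hG.mono (by omega)))
  rw [partialIdeal_succ]
  refine SocleFree.exchange (hG c (Nat.lt_succ_self c)) (ha ⟨c, Nat.lt_succ_self c⟩)
    (linearForm_mem_span a) ?_
  rw [← partialIdeal_sup, ← linearIdeal_sup_span]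
  have h1 := finrank_sup_span_singleton_le Λ a
  refine ih c (Nat.lt_succ_self c) _ G (by omega) ?_
  rw [linearIdeal_sup_span]
  exact (hG.mono (Nat.le_succ c)).sup_span_singleton fun j hj => ha ⟨j, Nat.lt_succ_of_le hj⟩

end LinearForms

/-! ### Quotients by homogeneous regular sequences are free -/

section Homogeneous

variable {k : Type*} [Field k] {n : ℕ}

/-- The ideal `J` contains all homogeneous components of its elements. -/
def HasComponents (J : Ideal (MvPolynomial (Fin n) k)) : Prop :=
  ∀ f ∈ J, ∀ j, homogeneousComponent j f ∈ J

theorem homogeneousComponent_mul {g : MvPolynomial (Fin n) k} {e : ℕ} (hg : g.IsHomogeneous e)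
    (f : MvPolynomial (Fin n) k) (D : ℕ) :
    homogeneousComponent D (f * g) = if e ≤ D then homogeneousComponent (D - e) f * g else 0 := by
  have h1 : homogeneousComponent D (f * g) =
      ∑ i ∈ Finset.range (f.totalDegree + 1),
        if D = i + e then homogeneousComponent i f * g else 0 := by
    conv_lhs => rw [← sum_homogeneousComponent f, Finset.sum_mul, map_sum]
    refine Finset.sum_congr rfl fun i _ => ?_
    exact homogeneousComponent_of_mem ((homogeneousComponent_isHomogeneous i f).mul hg)
  rw [h1]
  split_ifs with h
  · by_cases h2 : D - e ∈ Finset.range (f.totalDegree + 1)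
    · rw [Finset.sum_eq_single (D - e), if_pos (by omega)]
      · intro b _ hb
        rw [if_neg (by omega)]
      · exact fun h3 => absurd h2 h3
    · rw [homogeneousComponent_eq_zero _ _ (by rw [Finset.mem_range] at h2; omega), zero_mul]
      refine Finset.sum_eq_zero fun i hi => if_neg ?_
      rintro rfl
      exact h2 (by simpa using hi)
  · exact Finset.sum_eq_zero fun i _ => if_neg (by omega)

theorem hasComponents_span {s : Set (MvPolynomial (Fin n) k)}
    (hs : ∀ f ∈ s, ∃ e, f.IsHomogeneous e) : HasComponents (Ideal.span s) := by
  intro f hf j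
  have : ∀ a, homogeneousComponent j (a * f) ∈ Ideal.span s := by
    induction hf using Submodule.span_induction with
    | mem x hx =>
      intro a
      obtain ⟨e, he⟩ := hs x hx
      rw [homogeneousComponent_mul he]
      split_ifs
      · exact Ideal.mul_mem_left _ _ (Ideal.subset_span hx)
      · exact zero_mem _
    | zero => simp
    | add x y _ _ hx hy =>
      intro a
      rw [mul_add, map_add]
      exact add_mem (hx a) (hy a)
    | smul c x _ hx =>
      intro a
      rw [smul_eq_mul, ← mul_assoc]
      exact hx _
  simpa using this 1

theorem HasComponents.sup {I J : Ideal (MvPolynomial (Fin n) k)} (hI : HasComponents I)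
    (hJ : HasComponents J) : HasComponents (I ⊔ J) := by
  intro f hf j
  obtain ⟨a, ha, b, hb, rfl⟩ := Submodule.mem_sup.1 hf
  rw [map_add]
  exact add_mem (Ideal.mem_sup_left (hI a ha j)) (Ideal.mem_sup_right (hJ b hb j))

theorem hasComponents_linearIdeal (Λ : Submodule k (Fin n → k)) :
    HasComponents (linearIdeal Λ) :=
  hasComponents_span (by rintro _ ⟨a, _, rfl⟩; exact ⟨1, linearForm_isHomogeneous a⟩)

theorem HasComponents.partialIdeal {J : Ideal (MvPolynomial (Fin n) k)} (hJ : HasComponents J)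
    {G : ℕ → MvPolynomial (Fin n) k} {e : ℕ → ℕ} {c : ℕ} (hG : ∀ j < c, (G j).IsHomogeneous (e j)) :
    HasComponents (partialIdeal J G c) :=
  hJ.sup (hasComponents_span (by rintro _ ⟨j, hj, rfl⟩; exact ⟨e j, hG j hj⟩))

end Homogeneous

section Freeness

variable {k : Type*} [Field k]

/-- Combinations of the elements `b i` with coefficients polynomials in `G 0, …, G (t - 1)`. -/
noncomputable def polyCombination (k : Type*) [Field k] {R : Type*} [CommRing R] [Algebra k R]
    (t : ℕ) (G : ℕ → R) {ι : Type*} (b : ι → R) : (ι →₀ MvPolynomial (Fin t) k) →ₗ[k] R :=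
  Finsupp.lsum k fun i =>
    (LinearMap.mulRight k (b i)) ∘ₗ (aeval fun j : Fin t => G j).toLinearMap

theorem polyCombination_apply {R : Type*} [CommRing R] [Algebra k R] (t : ℕ) (G : ℕ → R)
    {ι : Type*} (b : ι → R) (p : ι →₀ MvPolynomial (Fin t) k) :
    polyCombination k t G b p = p.sum fun i q => aeval (fun j : Fin t => G j) q * b i := rfl

theorem polyCombination_smul {R : Type*} [CommRing R] [Algebra k R] (t : ℕ) (G : ℕ → R)
    {ι : Type*} (b : ι → R) (q : MvPolynomial (Fin t) k) (p : ι →₀ MvPolynomial (Fin t) k) :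
    polyCombination k t G b (q • p) =
      aeval (fun j : Fin t => G j) q * polyCombination k t G b p := by
  rw [polyCombination_apply, polyCombination_apply, Finsupp.sum_smul_index (by simp),
    Finsupp.mul_sum]
  exact Finsupp.sum_congr fun i _ => by rw [map_mul, mul_assoc]

theorem aeval_eq_eval₂_finSuccEquiv {R : Type*} [CommRing R] [Algebra k R] (t : ℕ) (G : ℕ → R)
    (q : MvPolynomial (Fin (t + 1)) k) :
    aeval (fun j : Fin (t + 1) => G j) q =
      (finSuccEquiv k t q).eval₂ (aeval fun j : Fin t => G (j + 1)).toRingHom (G 0) := by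
  induction q using MvPolynomial.induction_on with
  | C a =>
    have : finSuccEquiv k t (C a) = Polynomial.C (C a) := by
      simp [finSuccEquiv_apply]
    rw [this]; simp
  | add p q hp hq => rw [map_add, hp, hq, map_add, Polynomial.eval₂_add]
  | mul_X p i hp =>
    rw [map_mul, hp, map_mul, Polynomial.eval₂_mul]
    congr 1
    refine Fin.cases ?_ (fun i => ?_) i
    · rw [aeval_X, finSuccEquiv_X_zero, Polynomial.eval₂_X]; rfl
    · simp [finSuccEquiv_X_succ]

/-- Elements which are linearly independent over `k` modulo `J` and a regular sequence `G` are
linearly independent over the polynomials in `G` modulo `J`. -/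
theorem polyCombination_injective_mod (t : ℕ) : ∀ {R : Type*} [CommRing R] [Algebra k R]
    (J : Ideal R) (G : ℕ → R), RegularMod J G t → ∀ {ι : Type*} (b : ι → R),
    (∀ c : ι →₀ k, (c.sum fun i a => a • b i) ∈ partialIdeal J G t → c = 0) →
    ∀ p : ι →₀ MvPolynomial (Fin t) k, polyCombination k t G b p ∈ J → p = 0 := by
  induction t with
  | zero =>
    intro R _ _ J G _ ι b hb p hp
    have hC : ∀ q : MvPolynomial (Fin 0) k, q = C (coeff 0 q) := fun q => eq_C_of_isEmpty q
    have h := hb (p.mapRange (coeff 0) (coeff_zero 0)) (by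
      rw [partialIdeal_zero, Finsupp.sum_mapRange_index (by simp)]
      convert hp using 1
      rw [polyCombination_apply]
      refine Finsupp.sum_congr fun i _ => ?_
      conv_rhs => rw [hC (p i), aeval_C]
      rw [Algebra.smul_def])
    ext1 i
    have h1 := DFunLike.congr_fun h i
    rw [Finsupp.mapRange_apply, Finsupp.zero_apply] at h1
    rw [hC (p i), h1, C_0, Finsupp.zero_apply]
  | succ t ih =>
    intro R _ _ J G hG ι b hb p hp
    have hpart : ∀ j, partialIdeal (J ⊔ Ideal.span {G 0}) (fun j => G (j + 1)) j =
        partialIdeal J G (j + 1) := by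
      intro j
      rw [partialIdeal, partialIdeal, sup_assoc, ← Ideal.span_union, ← Set.image_singleton]
      congr 2
      ext x
      constructor
      · rintro (⟨_, rfl, rfl⟩ | ⟨i, hi, rfl⟩)
        · exact ⟨0, Nat.succ_pos _, rfl⟩
        · exact ⟨i + 1, Nat.succ_lt_succ hi, rfl⟩
      · rintro ⟨_ | i, hi, rfl⟩
        · exact Or.inl ⟨0, rfl, rfl⟩
        · exact Or.inr ⟨i, Nat.lt_of_succ_lt_succ hi, rfl⟩
    have ih' := ih (J ⊔ Ideal.span {G 0}) (fun j => G (j + 1))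
      (fun j hj => by rw [hpart]; exact hG (j + 1) (Nat.succ_lt_succ hj)) b
      (fun c hc => hb c (by rwa [hpart] at hc))
    set ev : MvPolynomial (Fin t) k →+* R := (aeval fun j : Fin t => G (j + 1)).toRingHom with hev
    -- all coefficients with respect to the first variable vanish, one degree after another
    have key : ∀ (D : ℕ) (P : ι →₀ Polynomial (MvPolynomial (Fin t) k)),
        (P.sum fun i q => q.eval₂ ev (G 0) * b i) ∈ J → ∀ i, (P i).coeff D = 0 := by
      have hzero : ∀ P : ι →₀ Polynomial (MvPolynomial (Fin t) k),
          (P.sum fun i q => q.eval₂ ev (G 0) * b i) ∈ J → ∀ i, (P i).coeff 0 = 0 := by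
        intro P hP i
        have h := ih' (P.mapRange (fun q => q.coeff 0) (Polynomial.coeff_zero 0)) (by
          rw [polyCombination_apply, Finsupp.sum_mapRange_index (by simp)]
          have hsub : (P.sum fun i q => q.eval₂ ev (G 0) * b i) -
              (P.sum fun i q => ev (q.coeff 0) * b i) ∈ Ideal.span {G 0} := by
            rw [Finsupp.sum, Finsupp.sum, ← Finset.sum_sub_distrib]
            refine sum_mem fun i _ => ?_
            rw [← sub_mul]
            refine Ideal.mul_mem_right _ _ ?_
            have h5 := congrArg (Polynomial.eval₂ ev (G 0)) (Polynomial.divX_mul_X_add (P i))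
            rw [Polynomial.eval₂_add, Polynomial.eval₂_mul, Polynomial.eval₂_X,
              Polynomial.eval₂_C] at h5
            rw [← h5, add_sub_cancel_right]
            exact Ideal.mul_mem_left _ _ (Ideal.mem_span_singleton_self (G 0))
          have := sub_mem (Ideal.mem_sup_left (T := Ideal.span {G 0}) hP)
            (Ideal.mem_sup_right (S := J) hsub)
          rwa [sub_sub_cancel] at this)
        simpa using DFunLike.congr_fun h i
      intro D
      induction D with
      | zero => exact hzero
      | succ D ihD =>
        intro P hP i
        have h0 := hzero P hP
        have := ihD (P.mapRange Polynomial.divX Polynomial.divX_zero) (by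
          have h1 := hG 0 (Nat.succ_pos t)
          rw [partialIdeal_zero] at h1
          refine h1 _ ?_
          convert hP using 1
          rw [Finsupp.sum_mapRange_index (by simp), Finsupp.mul_sum]
          refine Finsupp.sum_congr fun i _ => ?_
          conv_rhs => rw [← Polynomial.divX_mul_X_add (P i), h0 i]
          simp only [Polynomial.eval₂_mul, Polynomial.eval₂_X, map_zero, add_zero]
          ring) i
        rwa [Finsupp.mapRange_apply, Polynomial.coeff_divX] at this
    ext1 i
    rw [Finsupp.zero_apply, ← map_eq_zero_iff _ (finSuccEquiv k t).injective]
    ext1 D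
    have := key D (p.mapRange (finSuccEquiv k t) (map_zero _)) (by
      rw [Finsupp.sum_mapRange_index (by simp)]
      convert hp using 1
      rw [polyCombination_apply]
      exact Finsupp.sum_congr fun i _ => by rw [aeval_eq_eval₂_finSuccEquiv]) i
    rwa [Finsupp.mapRange_apply] at this

variable {n : ℕ}

/-- Homogeneous elements which span the quotient by `J` and homogeneous elements `G` of positive
degree span the quotient by `J` over the polynomials in `G`. -/
theorem exists_polyCombination_sub_mem {J : Ideal (MvPolynomial (Fin n) k)} (hJ : HasComponents J)
    {t : ℕ} {G : ℕ → MvPolynomial (Fin n) k} {e : ℕ → ℕ}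
    (hG : ∀ j < t, (G j).IsHomogeneous (e j)) (he : ∀ j < t, 0 < e j)
    {ι : Type*} {b : ι → MvPolynomial (Fin n) k} (hb : ∀ i, ∃ D, (b i).IsHomogeneous D)
    (hspan : Submodule.span k (Set.range b) ⊔ (partialIdeal J G t).restrictScalars k = ⊤)
    (r : MvPolynomial (Fin n) k) :
    ∃ p, r - polyCombination k t G b p ∈ J := by
  set N : Submodule k (MvPolynomial (Fin n) k) :=
    LinearMap.range (polyCombination k t G b) ⊔ J.restrictScalars k with hN
  suffices h : ∀ D r, r.IsHomogeneous D → r ∈ N by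
    have hr : r ∈ N := by
      rw [← sum_homogeneousComponent r]
      exact sum_mem fun i _ => h i _ (homogeneousComponent_isHomogeneous i r)
    obtain ⟨_, ⟨p, rfl⟩, a, ha, rfl⟩ := Submodule.mem_sup.1 hr
    exact ⟨p, by simpa using ha⟩
  have hbN : ∀ i, b i ∈ N := fun i => by
    refine Submodule.mem_sup_left ⟨Finsupp.single i 1, ?_⟩
    rw [polyCombination_apply, Finsupp.sum_single_index (by simp), map_one, one_mul]
  have hGN : ∀ j < t, ∀ x ∈ N, x * G j ∈ N := by
    intro j hj x hx
    obtain ⟨_, ⟨p, rfl⟩, a, ha, rfl⟩ := Submodule.mem_sup.1 hx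
    rw [add_mul]
    refine Submodule.add_mem_sup ⟨(X ⟨j, hj⟩ : MvPolynomial (Fin t) k) • p, ?_⟩
      (Ideal.mul_mem_right _ J ha)
    rw [polyCombination_smul, aeval_X, mul_comm]
  intro D
  induction D using Nat.strong_induction_on with
  | _ D ih =>
  intro r hr
  obtain ⟨s, hs, y, hy, hsy⟩ := Submodule.mem_sup.1 (hspan ▸ Submodule.mem_top (x := r))
  obtain ⟨a, ha, z, hz, rfl⟩ := Submodule.mem_sup.1 (show y ∈ J ⊔ _ from hy)
  rw [← homogeneousComponent_eq_self hr, ← hsy, map_add, map_add]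
  refine add_mem ?_ (add_mem (Submodule.mem_sup_right (hJ a ha D)) ?_)
  · have : Submodule.span k (Set.range b) ≤ N.comap (homogeneousComponent D) := by
      rw [Submodule.span_le]
      rintro _ ⟨i, rfl⟩
      change homogeneousComponent D (b i) ∈ N
      obtain ⟨D', hD'⟩ := hb i
      rw [homogeneousComponent_of_mem hD']
      split_ifs
      · exact hbN i
      · exact zero_mem _
    exact this hs
  · clear hsy hy
    have : ∀ c, homogeneousComponent D (c * z) ∈ N := by
      induction hz using Submodule.span_induction with
      | mem x hx =>
        obtain ⟨j, hj, rfl⟩ := hx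
        intro c
        rw [homogeneousComponent_mul (hG j hj)]
        split_ifs with hle
        · have := he j hj
          exact hGN j hj _ (ih _ (by omega) _ (homogeneousComponent_isHomogeneous _ _))
        · exact zero_mem _
      | zero => simp
      | add x y _ _ hx hy =>
        intro c
        rw [mul_add, map_add]
        exact add_mem (hx c) (hy c)
      | smul c x _ hx =>
        intro c'
        rw [smul_eq_mul, ← mul_assoc]
        exact hx _
    simpa using this 1

/-- The quotient by a homogeneous ideal `J` is free over the polynomials in a homogeneous
sequence `G` which is regular modulo `J`. -/
theorem exists_basis_mod {J : Ideal (MvPolynomial (Fin n) k)} (hJ : HasComponents J)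
    {t : ℕ} {G : ℕ → MvPolynomial (Fin n) k} {e : ℕ → ℕ}
    (hG : ∀ j < t, (G j).IsHomogeneous (e j)) (he : ∀ j < t, 0 < e j) (hreg : RegularMod J G t) :
    ∃ (ι : Type) (b : ι → MvPolynomial (Fin n) k),
      (∀ r, ∃ p, r - polyCombination k t G b p ∈ J) ∧
      ∀ p, polyCombination k t G b p ∈ J → p = 0 := by
  let I := partialIdeal J G t
  let mk : MvPolynomial (Fin n) k →ₗ[k] (MvPolynomial (Fin n) k ⧸ I) :=
    (Ideal.Quotient.mkₐ k I).toLinearMap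
  obtain ⟨ι, μ, -, hspan, hli⟩ := exists_linearIndependent' k
    (fun μ : Fin n →₀ ℕ => mk (monomial μ (1 : k)))
  refine ⟨ι, fun i => monomial (μ i) (1 : k), exists_polyCombination_sub_mem hJ hG he
      (fun i => ⟨_, isHomogeneous_monomial (1 : k) rfl⟩) ?_,
    polyCombination_injective_mod t J G hreg _ fun c hc => ?_⟩
  · rw [eq_top_iff]
    intro r _
    have h1 : mk r ∈
        Submodule.span k (Set.range fun μ : Fin n →₀ ℕ => mk (monomial μ (1 : k))) := by
      rw [r.as_sum, map_sum]
      refine sum_mem fun ν _ => ?_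
      rw [← mul_one (coeff ν r), ← smul_eq_mul, ← smul_monomial, map_smul]
      exact Submodule.smul_mem _ _ (Submodule.subset_span ⟨ν, rfl⟩)
    rw [← hspan] at h1
    have h2 : Set.range ((fun μ : Fin n →₀ ℕ => mk (monomial μ (1 : k))) ∘ μ) =
        mk '' Set.range fun i => monomial (μ i) (1 : k) := by
      rw [← Set.range_comp]; rfl
    rw [h2, ← Submodule.map_span] at h1
    obtain ⟨s, hs, hsr⟩ := h1
    have h3 : r - s ∈ I := (Ideal.Quotient.eq (I := I)).1 hsr.symm
    rw [← add_sub_cancel s r]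
    exact Submodule.add_mem_sup hs h3
  · rw [linearIndependent_iff] at hli
    refine hli c ?_
    have h1 : mk (c.sum fun i a => a • monomial (μ i) (1 : k)) = 0 :=
      Ideal.Quotient.eq_zero_iff_mem.2 hc
    rw [Finsupp.linearCombination_apply, ← h1, map_finsuppSum]
    exact Finsupp.sum_congr fun i _ => by rw [map_smul]; rfl

/-- A nonzero polynomial in a homogeneous regular sequence is a nonzerodivisor. -/
theorem nonZeroDivisorMod_aeval {J : Ideal (MvPolynomial (Fin n) k)} (hJ : HasComponents J)
    {t : ℕ} {G : ℕ → MvPolynomial (Fin n) k} {e : ℕ → ℕ}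
    (hG : ∀ j < t, (G j).IsHomogeneous (e j)) (he : ∀ j < t, 0 < e j) (hreg : RegularMod J G t)
    {q : MvPolynomial (Fin t) k} (hq : q ≠ 0) :
    NonZeroDivisorMod J (aeval (fun j : Fin t => G j) q) := by
  obtain ⟨ι, b, hspan, hind⟩ := exists_basis_mod hJ hG he hreg
  intro u hu
  obtain ⟨p, hp⟩ := hspan u
  have h1 : polyCombination k t G b (q • p) ∈ J := by
    rw [polyCombination_smul, ← sub_sub_cancel
      (aeval (fun j : Fin t => G j) q * u) (aeval (fun j : Fin t => G j) q * _), ← mul_sub]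
    exact sub_mem hu (Ideal.mul_mem_left _ _ hp)
  have h2 := (smul_eq_zero.1 (hind _ h1)).resolve_left hq
  rw [h2, map_zero, sub_zero] at hp
  exact hp

end Freeness

/-! ### Zero divisors of bounded degree -/

section BoundedZeroDivisors

variable {k : Type*} [Field k] {n : ℕ}

theorem homogeneousComponent_aeval_linear {m : ℕ} {l : Fin m → MvPolynomial (Fin n) k}
    (hl : ∀ j, (l j).IsHomogeneous 1) (c : MvPolynomial (Fin m) k) (D : ℕ) :
    homogeneousComponent D (aeval l c) = aeval l (homogeneousComponent D c) := by
  have h : ∀ i, (aeval l (homogeneousComponent i c)).IsHomogeneous i := fun i => by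
    simpa using (homogeneousComponent_isHomogeneous i c).aeval l hl
  conv_lhs => rw [← sum_homogeneousComponent c, map_sum, map_sum]
  by_cases hD : D ∈ Finset.range (c.totalDegree + 1)
  · rw [Finset.sum_eq_single_of_mem D hD]
    · exact homogeneousComponent_eq_self (h D)
    · intro i _ hi
      rw [homogeneousComponent_of_mem (h i), if_neg (Ne.symm hi)]
  · rw [homogeneousComponent_eq_zero D c (by rw [Finset.mem_range] at hD; omega), map_zero]
    refine Finset.sum_eq_zero fun i hi => ?_
    rw [homogeneousComponent_of_mem (h i), if_neg]
    rintro rfl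
    exact hD hi

/-- If the linear forms `y` generate modulo `I` the space of linear forms, and `I` contains all
forms of degree at least `b`, then the monomials in `y` with exponents less than `b` span the
quotient by `I`. -/
theorem span_prod_pow_sup_eq_top {I : Ideal (MvPolynomial (Fin n) k)} {q b : ℕ}
    (y : Fin q → MvPolynomial (Fin n) k)
    (hX : ∀ i, X i ∈ Submodule.span k (Set.range y) ⊔ I.restrictScalars k)
    (hb : ∀ D ≥ b, ∀ f : MvPolynomial (Fin n) k, f.IsHomogeneous D → f ∈ I) :
    Submodule.span k (Set.range fun α : Fin q → Fin b => ∏ j, y j ^ (α j : ℕ)) ⊔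
      I.restrictScalars k = ⊤ := by
  classical
  let V : ℕ → Submodule k (MvPolynomial (Fin n) k) := fun D =>
    Submodule.span k ((fun α : Fin q → ℕ => ∏ j, y j ^ α j) '' {α | ∑ j, α j = D})
  have hmul : ∀ D, ∀ x ∈ V D, ∀ z ∈ Submodule.span k (Set.range y), z * x ∈ V (D + 1) := by
    intro D x hx z hz
    refine Submodule.span_induction₂ (p := fun z x _ _ => z * x ∈ V (D + 1)) ?_ ?_ ?_ ?_ ?_ ?_ ?_
      hz hx
    · rintro _ _ ⟨i, rfl⟩ ⟨α, hα, rfl⟩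
      refine Submodule.subset_span ⟨α + Pi.single i 1, ?_, ?_⟩
      · have hα' : ∑ j, α j = D := hα
        simp [Finset.sum_add_distrib, hα']
      · simp only [Pi.add_apply, pow_add, Finset.prod_mul_distrib]
        rw [mul_comm]
        congr 1
        rw [Finset.prod_eq_single i]
        · simp
        · intro j _ hj; simp [hj]
        · simp
    · intro x _; simp
    · intro x _; simp
    · intro x y z _ _ _ h1 h2; rw [add_mul]; exact add_mem h1 h2
    · intro x y z _ _ _ h1 h2; rw [mul_add]; exact add_mem h1 h2
    · intro r x y _ _ h; rw [smul_mul_assoc]; exact Submodule.smul_mem _ _ h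
    · intro r x y _ _ h; rw [mul_smul_comm]; exact Submodule.smul_mem _ _ h
  have hmon : ∀ (D : ℕ) (μ : Fin n →₀ ℕ), μ.degree = D →
      monomial μ (1 : k) ∈ V D ⊔ I.restrictScalars k := by
    intro D
    induction D with
    | zero =>
      intro μ hμ
      rw [Finsupp.degree_eq_zero_iff] at hμ
      subst hμ
      exact Submodule.mem_sup_left (Submodule.subset_span ⟨0, by simp, by simp⟩)
    | succ D ih =>
      intro μ hμ
      have hμ0 : μ ≠ 0 := by rintro rfl; simp at hμ
      obtain ⟨i, hi⟩ := Finsupp.ne_iff.1 hμ0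
      have hsplit : Finsupp.single i 1 + (μ - Finsupp.single i 1) = μ :=
        add_tsub_cancel_of_le (by simpa using Nat.one_le_iff_ne_zero.2 hi)
      have hdeg : (μ - Finsupp.single i 1).degree = D := by
        rw [← hsplit, map_add, Finsupp.degree_single] at hμ
        omega
      have h1 : monomial μ (1 : k) = X i * monomial (μ - Finsupp.single i 1) 1 := by
        rw [X, monomial_mul, hsplit, one_mul]
      rw [h1]
      obtain ⟨z, hz, a, ha, hza⟩ := Submodule.mem_sup.1 (hX i)
      obtain ⟨x, hx, a', ha', hxa⟩ := Submodule.mem_sup.1 (ih _ hdeg)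
      rw [← hxa, ← hza, add_mul, mul_add, add_assoc]
      exact Submodule.add_mem_sup (hmul D x hx z hz)
        (add_mem (Ideal.mul_mem_left I _ ha') (Ideal.mul_mem_right _ I ha))
  rw [eq_top_iff]
  intro r _
  rw [r.as_sum]
  refine sum_mem fun μ _ => ?_
  rw [← mul_one (coeff μ r), ← smul_eq_mul, ← smul_monomial]
  refine Submodule.smul_mem _ _ ?_
  by_cases hμ : b ≤ μ.degree
  · exact Submodule.mem_sup_right (hb _ hμ _ (isHomogeneous_monomial _ rfl))
  · have hle : V μ.degree ≤
        Submodule.span k (Set.range fun α : Fin q → Fin b => ∏ j, y j ^ (α j : ℕ)) := ?_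
    · exact sup_le_sup_right hle _ (hmon _ μ rfl)
    rw [Submodule.span_le]
    rintro _ ⟨α, hα, rfl⟩
    have hα' : ∑ j, α j = μ.degree := hα
    refine Submodule.subset_span ⟨fun j => ⟨α j, ?_⟩, rfl⟩
    have := Finset.single_le_sum (f := α) (fun _ _ => Nat.zero_le _) (Finset.mem_univ j)
    omega

/-- A homogeneous equation of integral dependence of degree `N`, modulo `J`, of a form `h` of
degree `e` over the polynomials in `l`: the coefficients are `a 0, …, a N = 1`. -/
structure IsIntegralRelation (J : Ideal (MvPolynomial (Fin n) k)) {m : ℕ}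
    (l : Fin m → MvPolynomial (Fin n) k) (h : MvPolynomial (Fin n) k) (e N : ℕ)
    (a : ℕ → MvPolynomial (Fin m) k) : Prop where
  top : a N = 1
  homogeneous : ∀ i ≤ N, (a i).IsHomogeneous ((N - i) * e)
  mem : ∑ i ∈ Finset.range (N + 1), aeval l (a i) * h ^ i ∈ J

/-- The Cayley-Hamilton theorem for multiplication by `h`: a finite ring homomorphism is integral,
and the degree of the equation is at most the number of generators. -/
theorem exists_monic_eval₂_eq_zero {A B ι : Type*} [CommRing A] [Nontrivial A] [CommRing B]
    [Fintype ι] (f : A →+* B) (Y : ι → B)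
    (hY : ∀ x : B, ∃ p : ι →₀ A, x = p.sum fun i c => f c * Y i) (h : B) :
    ∃ χ : Polynomial A, χ.Monic ∧ χ.natDegree ≤ Fintype.card ι ∧ χ.eval₂ f h = 0 := by
  classical
  let _ : Algebra A B := f.toAlgebra
  have hspan : Submodule.span A (Set.range Y) = ⊤ := by
    rw [eq_top_iff]
    intro x _
    obtain ⟨p, rfl⟩ := hY x
    refine sum_mem fun i _ => ?_
    change f (p i) * Y i ∈ Submodule.span A (Set.range Y)
    have h1 : f (p i) * Y i = p i • Y i := (Algebra.smul_def _ _).symm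
    rw [h1]
    exact Submodule.smul_mem _ _ (Submodule.subset_span ⟨i, rfl⟩)
  have hfin : Module.Finite A B := ⟨hspan ▸ Submodule.fg_span (Set.finite_range _)⟩
  obtain ⟨χ, hmonic, hdeg, hχ⟩ := LinearMap.exists_monic_and_natDegree_eq_and_aeval_eq_zero
    A (Algebra.lmul A B h)
  refine ⟨χ, hmonic, ?_, ?_⟩
  · rw [hdeg, ← hspan]
    refine (Submodule.spanFinrank_span_le_ncard_of_finite (Set.finite_range _)).trans ?_
    rw [← Set.image_univ]
    refine (Set.ncard_image_le Set.finite_univ).trans ?_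
    rw [Set.ncard_univ, Nat.card_eq_fintype_card]
  · rw [Polynomial.aeval_algHom_apply] at hχ
    have hχ1 : Polynomial.aeval h χ = 0 := by
      simpa using LinearMap.congr_fun hχ 1
    exact hχ1

/-- An equation of integral dependence for `h` modulo `J`: the quotient by `J` is a module
generated over the polynomials in `l` by `b ^ q` monomials in `y`. -/
theorem exists_isIntegralRelation {J : Ideal (MvPolynomial (Fin n) k)} (hJ : HasComponents J)
    {m q b : ℕ} {l : ℕ → MvPolynomial (Fin n) k} (hl : ∀ j, (l j).IsHomogeneous 1)
    {y : Fin q → MvPolynomial (Fin n) k} (hy : ∀ j, (y j).IsHomogeneous 1)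
    (hX : ∀ i, X i ∈ Submodule.span k (Set.range y) ⊔ (partialIdeal J l m).restrictScalars k)
    (hb : ∀ D ≥ b, ∀ f : MvPolynomial (Fin n) k, f.IsHomogeneous D → f ∈ partialIdeal J l m)
    {h : MvPolynomial (Fin n) k} {e : ℕ} (hh : h.IsHomogeneous e) :
    ∃ N ≤ b ^ q, ∃ a, IsIntegralRelation J (fun j : Fin m => l j) h e N a := by
  classical
  set ψ : MvPolynomial (Fin m) k →ₐ[k] MvPolynomial (Fin n) k := aeval fun j : Fin m => l j with hψ
  let Y : (Fin q → Fin b) → MvPolynomial (Fin n) k := fun α => ∏ j, y j ^ (α j : ℕ)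
  have hY : ∀ α, ∃ D, (Y α).IsHomogeneous D := fun α =>
    ⟨_, IsHomogeneous.prod _ _ _ fun j _ => (hy j).pow (α j)⟩
  have hgen := exists_polyCombination_sub_mem hJ (t := m) (G := l) (e := fun _ => 1)
    (fun j _ => hl j) (fun _ _ => one_pos) hY (span_prod_pow_sup_eq_top y hX hb)
  obtain ⟨χ, hmonic, hN, hχ⟩ := exists_monic_eval₂_eq_zero
    ((Ideal.Quotient.mk J).comp ψ.toRingHom) (fun α => Ideal.Quotient.mk J (Y α)) (fun x => by
      obtain ⟨r, rfl⟩ := Ideal.Quotient.mk_surjective x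
      obtain ⟨p, hp⟩ := hgen r
      refine ⟨p, ?_⟩
      rw [(Ideal.Quotient.eq).2 hp, polyCombination_apply, Finsupp.sum, map_sum]
      exact Finset.sum_congr rfl fun α _ => map_mul _ _ _) (Ideal.Quotient.mk J h)
  have hN : χ.natDegree ≤ b ^ q := by simpa using hN
  have hrel : ∑ i ∈ Finset.range (χ.natDegree + 1), ψ (χ.coeff i) * h ^ i ∈ J := by
    rw [← Ideal.Quotient.eq_zero_iff_mem, map_sum, ← hχ, Polynomial.eval₂_eq_sum_range]
    refine Finset.sum_congr rfl fun i _ => ?_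
    rw [map_mul, map_pow]
    rfl
  refine ⟨χ.natDegree, hN, fun i => homogeneousComponent ((χ.natDegree - i) * e) (χ.coeff i),
    ?_, fun i _ => homogeneousComponent_isHomogeneous _ _, ?_⟩
  · simp [hmonic]
  · have := hJ _ hrel (χ.natDegree * e)
    rw [map_sum] at this
    convert this using 1
    refine Finset.sum_congr rfl fun i hi => ?_
    have hi' : i ≤ χ.natDegree := Nat.lt_succ_iff.1 (Finset.mem_range.1 hi)
    rw [homogeneousComponent_mul (hh.pow i), if_pos (by rw [mul_comm]; gcongr),
      homogeneousComponent_aeval_linear (fun j => hl j), tsub_mul, mul_comm i e]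

/-- A form `h` is killed, modulo `J`, by a form `u` of bounded degree, or a nonzero polynomial of
bounded degree in `l` is a multiple of `h` modulo `J`: the constant term of an equation of integral
dependence for `h` of minimal degree is zero or not. -/
theorem exists_annihilator_or_exists_multiple {J : Ideal (MvPolynomial (Fin n) k)}
    (hJ : HasComponents J)
    {m q b : ℕ} {l : ℕ → MvPolynomial (Fin n) k} (hl : ∀ j, (l j).IsHomogeneous 1)
    {y : Fin q → MvPolynomial (Fin n) k} (hy : ∀ j, (y j).IsHomogeneous 1)
    (hX : ∀ i, X i ∈ Submodule.span k (Set.range y) ⊔ (partialIdeal J l m).restrictScalars k)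
    (hb : ∀ D ≥ b, ∀ f : MvPolynomial (Fin n) k, f.IsHomogeneous D → f ∈ partialIdeal J l m)
    {h : MvPolynomial (Fin n) k} {e : ℕ} (hh : h.IsHomogeneous e) :
    (∃ D ≤ b ^ q * e, ∃ u : MvPolynomial (Fin n) k, u.IsHomogeneous D ∧ u ∉ J ∧ h * u ∈ J) ∨
    ∃ N ≤ b ^ q, ∃ c : MvPolynomial (Fin m) k, c ≠ 0 ∧ c.IsHomogeneous (N * e) ∧
      aeval (fun j : Fin m => l j) c ∈ J ⊔ Ideal.span {h} := by
  classical
  obtain ⟨N₀, hN₀, ha₀⟩ := exists_isIntegralRelation hJ hl hy hX hb hh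
  have hex : ∃ N, ∃ a, IsIntegralRelation J (fun j : Fin m => l j) h e N a := ⟨N₀, ha₀⟩
  obtain ⟨a, ha⟩ := Nat.find_spec hex
  have hmin := fun N => Nat.find_min (H := hex) (m := N)
  have hle : Nat.find hex ≤ b ^ q := (Nat.find_le ha₀).trans hN₀
  generalize Nat.find hex = N at ha hmin hle
  have hsum := ha.mem
  rw [Finset.sum_range_succ', pow_zero, mul_one] at hsum
  have hfactor : ∑ i ∈ Finset.range N, aeval (fun j : Fin m => l j) (a (i + 1)) * h ^ (i + 1) =
      h * ∑ i ∈ Finset.range N, aeval (fun j : Fin m => l j) (a (i + 1)) * h ^ i := by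
    rw [Finset.mul_sum]
    exact Finset.sum_congr rfl fun i _ => by ring
  rw [hfactor] at hsum
  by_cases h0 : a 0 = 0
  · left
    rcases N with _ | N
    · exact absurd (h0.symm.trans ha.top) zero_ne_one
    rw [h0, map_zero, add_zero] at hsum
    refine ⟨N * e, Nat.mul_le_mul_right e (by omega), _, ?_, fun hu => ?_, hsum⟩
    · refine IsHomogeneous.sum _ _ _ fun i hi => ?_
      have hi' : i < N + 1 := Finset.mem_range.1 hi
      have h1 := (ha.homogeneous (i + 1) hi').aeval (fun j : Fin m => l j) (fun j => hl j)
      have h2 := h1.mul (hh.pow i)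
      convert h2 using 1
      rw [one_mul, mul_comm e i, ← add_mul]
      congr 1
      omega
    · refine hmin N (Nat.lt_succ_self N) ⟨fun i => a (i + 1), ha.top, fun i hi => ?_, hu⟩
      have := ha.homogeneous (i + 1) (by omega)
      rwa [Nat.add_sub_add_right] at this
  · right
    refine ⟨N, hle, a 0, h0, by simpa using ha.homogeneous 0 (Nat.zero_le _), ?_⟩
    have h1 := sub_mem (Ideal.mem_sup_left (T := Ideal.span {h}) hsum)
      (Ideal.mem_sup_right (S := J) (Ideal.mul_mem_right
        (∑ i ∈ Finset.range N, aeval (fun j : Fin m => l j) (a (i + 1)) * h ^ i) _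
        (Ideal.mem_span_singleton_self h)))
    rwa [add_sub_cancel_left] at h1

theorem exists_sup_span_range_eq_top {Λ : Submodule k (Fin n → k)} {q : ℕ}
    (h : Module.finrank k Λ + q = n) :
    ∃ y : Fin q → Fin n → k, Λ ⊔ Submodule.span k (Set.range y) = ⊤ := by
  obtain ⟨C, hC⟩ := Λ.exists_isCompl
  have hq : Module.finrank k C = q := by
    have := Submodule.finrank_add_eq_of_isCompl hC
    rw [Module.finrank_fin_fun] at this
    omega
  let y := Module.finBasisOfFinrankEq k C hq
  refine ⟨fun i => y i, ?_⟩
  have : Submodule.span k (Set.range fun i => (y i : Fin n → k)) = C := by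
    have h1 := congrArg (Submodule.map C.subtype) y.span_eq
    rw [Submodule.map_span, Submodule.map_top, Submodule.range_subtype, ← Set.range_comp] at h1
    exact h1
  rw [this, hC.sup_eq_top]

/-- Linear forms spanning a complement of `Λ` span all linear forms modulo `linearIdeal Λ`. -/
theorem X_mem_span_sup {Λ : Submodule k (Fin n → k)} {q : ℕ} {y : Fin q → Fin n → k}
    (hy : Λ ⊔ Submodule.span k (Set.range y) = ⊤) {I : Ideal (MvPolynomial (Fin n) k)}
    (hI : linearIdeal Λ ≤ I) (i : Fin n) :
    X i ∈ Submodule.span k (Set.range fun j => linearForm k n (y j)) ⊔ I.restrictScalars k := by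
  obtain ⟨a, ha, b, hb, hab⟩ := Submodule.mem_sup.1
    (hy ▸ Submodule.mem_top (x := (Pi.single i 1 : Fin n → k)))
  rw [← linearForm_single, ← hab, map_add, add_comm]
  refine Submodule.add_mem_sup ?_ (hI (Ideal.subset_span ⟨a, ha, rfl⟩))
  have := Submodule.mem_map_of_mem (f := linearForm k n) hb
  rwa [Submodule.map_span, ← Set.range_comp] at this

theorem partialIdeal_ne_top {Λ : Submodule k (Fin n → k)} {G : ℕ → MvPolynomial (Fin n) k}
    {e : ℕ → ℕ} {c : ℕ} (hG : ∀ j < c, (G j).IsHomogeneous (e j)) (he : ∀ j < c, 0 < e j) :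
    partialIdeal (linearIdeal Λ) G c ≠ ⊤ := by
  have hz : ∀ {f : MvPolynomial (Fin n) k} {D : ℕ}, f.IsHomogeneous D → 0 < D →
      f ∈ RingHom.ker (constantCoeff (R := k) (σ := Fin n)) := by
    intro f D hf hD
    rw [RingHom.mem_ker, constantCoeff_eq]
    exact hf.coeff_eq_zero (by simpa using hD.ne)
  have hle : partialIdeal (linearIdeal Λ) G c ≤ RingHom.ker (constantCoeff (R := k)) := by
    refine sup_le (Ideal.span_le.2 ?_) (Ideal.span_le.2 ?_)
    · rintro _ ⟨a, _, rfl⟩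
      exact hz (linearForm_isHomogeneous a) one_pos
    · rintro _ ⟨j, hj, rfl⟩
      exact hz (hG j hj) (he j hj)
  intro h
  have h1 := hle (h ▸ Submodule.mem_top (x := (1 : MvPolynomial (Fin n) k)))
  simp at h1

theorem finrank_sup_span_singleton_eq {Λ : Submodule k (Fin n → k)} {a : Fin n → k} {c : ℕ}
    {G : ℕ → MvPolynomial (Fin n) k} {e : ℕ → ℕ} (hG : ∀ j < c, (G j).IsHomogeneous (e j))
    (he : ∀ j < c, 0 < e j)
    (ha : NonZeroDivisorMod (partialIdeal (linearIdeal Λ) G c) (linearForm k n a)) :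
    Module.finrank k ↥(Λ ⊔ Submodule.span k {a}) = Module.finrank k Λ + 1 := by
  refine le_antisymm (finrank_sup_span_singleton_le Λ a) ?_
  refine Submodule.finrank_lt_finrank_of_lt (lt_of_le_of_ne le_sup_left fun h => ?_)
  have haΛ : a ∈ Λ := by
    rw [h]
    exact Submodule.mem_sup_right (Submodule.mem_span_singleton_self a)
  apply partialIdeal_ne_top (Λ := Λ) hG he
  rw [Ideal.eq_top_iff_one]
  refine ha 1 ?_
  rw [mul_one]
  exact le_partialIdeal c (Ideal.subset_span ⟨a, haΛ, rfl⟩)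

/-- A bound, depending only on the number `c` and the maximal degree `d` of the terms of a
homogeneous regular sequence of maximal length, for the degrees in which the quotient lives. -/
def lengthBound : ℕ → ℕ → ℕ
  | 0, _ => 1
  | c + 1, d => lengthBound c d + lengthBound c d ^ c * d

/-- The quotient by a homogeneous regular sequence of maximal length vanishes in large degrees.
The last term is exchanged for a generic linear form `l`; a power of `l` is then a multiple of that
term. -/
theorem mem_partialIdeal_of_lengthBound_le [Infinite k] (d : ℕ) (c : ℕ) :
    ∀ (Λ : Submodule k (Fin n → k)) (G : ℕ → MvPolynomial (Fin n) k) (e : ℕ → ℕ),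
      Module.finrank k Λ + c = n → (∀ j < c, (G j).IsHomogeneous (e j)) → (∀ j < c, 0 < e j) →
      (∀ j < c, e j ≤ d) → RegularMod (linearIdeal Λ) G c → ∀ D ≥ lengthBound c d,
      ∀ f : MvPolynomial (Fin n) k, f.IsHomogeneous D → f ∈ partialIdeal (linearIdeal Λ) G c := by
  induction c with
  | zero =>
    intro Λ G e hΛ _ _ _ _ D hD f hf
    have hΛ' : Λ = ⊤ := Submodule.eq_top_of_finrank_eq (by rw [Module.finrank_fin_fun]; omega)
    rw [partialIdeal_zero, f.as_sum]
    refine sum_mem fun μ hμ => ?_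
    have hμD : μ.degree = D := by
      by_contra h
      exact mem_support_iff.1 hμ (hf.coeff_eq_zero h)
    have hμ0 : μ ≠ 0 := by
      rintro rfl
      simp only [lengthBound] at hD
      simp at hμD
      omega
    obtain ⟨i, hi⟩ := Finsupp.ne_iff.1 hμ0
    have hsplit : Finsupp.single i 1 + (μ - Finsupp.single i 1) = μ :=
      add_tsub_cancel_of_le (by simpa using Nat.one_le_iff_ne_zero.2 hi)
    rw [← hsplit, ← one_mul (coeff _ f), ← monomial_mul]
    refine Ideal.mul_mem_right _ _ (Ideal.subset_span ⟨Pi.single i 1, ?_, linearForm_single i⟩)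
    rw [hΛ']; trivial
  | succ c ih =>
    intro Λ G e hΛ hG he hed hreg
    obtain ⟨a, ha⟩ := exists_linearForm_nonZeroDivisorMod
      (fun j : Fin (c + 1) => partialIdeal (linearIdeal Λ) G j)
      (fun j => socleFree_of_regularMod j Λ G (by omega) (hreg.mono (by omega)))
    have hGc : ∀ j < c, (G j).IsHomogeneous (e j) := fun j hj => hG j (by omega)
    have hec : ∀ j < c, 0 < e j := fun j hj => he j (by omega)
    set l := linearForm k n a with hl
    set J := partialIdeal (linearIdeal Λ) G c with hJdef
    have hJ : HasComponents J := (hasComponents_linearIdeal Λ).partialIdeal hGc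
    have hfr := finrank_sup_span_singleton_eq hGc hec (ha ⟨c, Nat.lt_succ_self c⟩)
    have hsup : partialIdeal (linearIdeal (Λ ⊔ Submodule.span k {a})) G c = J ⊔ Ideal.span {l} := by
      rw [linearIdeal_sup_span, partialIdeal_sup]
    have hb := ih (Λ ⊔ Submodule.span k {a}) G e (by omega) hGc hec
      (fun j hj => hed j (by omega)) (by
        rw [linearIdeal_sup_span]
        exact (hreg.mono (Nat.le_succ c)).sup_span_singleton
          fun j hj => ha ⟨j, Nat.lt_succ_of_le hj⟩)
    rw [hsup] at hb
    have hpart : partialIdeal J (fun _ => l) 1 = J ⊔ Ideal.span {l} := by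
      rw [partialIdeal_succ, partialIdeal_zero]
    obtain ⟨y, hy⟩ := exists_sup_span_range_eq_top
      (Λ := Λ ⊔ Submodule.span k {a}) (q := c) (by omega)
    have hlinle : linearIdeal (Λ ⊔ Submodule.span k {a}) ≤ J ⊔ Ideal.span {l} :=
      hsup ▸ le_partialIdeal c
    have halt := exists_annihilator_or_exists_multiple hJ (m := 1) (l := fun _ => l)
      (fun _ => linearForm_isHomogeneous a) (fun j => linearForm_isHomogeneous (y j))
      (by rw [hpart]; exact X_mem_span_sup hy hlinle)
      (by rw [hpart]; exact hb) (hG c (Nat.lt_succ_self c))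
    obtain ⟨_, _, u, _, huJ, hu⟩ | ⟨N, hN, p, hp0, hp, hpJ⟩ := halt
    · exact absurd (hreg c (Nat.lt_succ_self c) u hu) huJ
    rw [← partialIdeal_succ] at hpJ
    -- a form in one variable is a power of that variable, up to a constant
    have hpow : l ^ (N * e c) ∈ partialIdeal (linearIdeal Λ) G (c + 1) := by
      obtain ⟨μ, hμ⟩ := MvPolynomial.ne_zero_iff.1 hp0
      have hν : ∀ ν, coeff ν p ≠ 0 → ν = Finsupp.single 0 (N * e c) := fun ν hν => by
        have h1 : ν.degree = N * e c := by
          by_contra h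
          exact hν (hp.coeff_eq_zero h)
        refine Finsupp.ext fun i => ?_
        rw [Subsingleton.elim i 0, ← h1, Finsupp.degree_eq_sum]
        simp
      have hpm : p = monomial (Finsupp.single 0 (N * e c)) (coeff μ p) := by
        ext ν
        rw [coeff_monomial]
        split_ifs with h
        · rw [← h, hν μ hμ, h]
        · by_contra h'
          exact h (hν ν h').symm
      rw [hpm, aeval_monomial, Finsupp.prod_single_index (h := fun _ D => l ^ D) (pow_zero l),
        MvPolynomial.algebraMap_eq] at hpJ
      have h2 := Ideal.mul_mem_left _ (C (coeff μ p)⁻¹) hpJ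
      rwa [← mul_assoc, ← C_mul, inv_mul_cancel₀ hμ, C_1, one_mul] at h2
    have hiter : ∀ j, ∀ D ≥ lengthBound c d + j, ∀ f : MvPolynomial (Fin n) k,
        f.IsHomogeneous D → f ∈ J ⊔ Ideal.span {l ^ j} := by
      intro j
      induction j with
      | zero => intro D _ f _; simp
      | succ j ihj =>
        intro D hD f hf
        obtain ⟨x, hx, z, hz, hxz⟩ := Submodule.mem_sup.1 (hb D (by omega) f hf)
        obtain ⟨g, rfl⟩ := Ideal.mem_span_singleton.1 hz
        rw [← homogeneousComponent_eq_self hf, ← hxz, map_add, mul_comm l g,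
          homogeneousComponent_mul (linearForm_isHomogeneous a), if_pos (by omega)]
        refine add_mem (Ideal.mem_sup_left (hJ x hx D)) ?_
        obtain ⟨x', hx', z', hz', hxz'⟩ := Submodule.mem_sup.1 (ihj (D - 1) (by omega) _
          (homogeneousComponent_isHomogeneous (D - 1) g))
        obtain ⟨g', rfl⟩ := Ideal.mem_span_singleton.1 hz'
        rw [← hxz', add_mul]
        refine add_mem (Ideal.mem_sup_left (Ideal.mul_mem_right _ _ hx')) (Ideal.mem_sup_right ?_)
        exact Ideal.mem_span_singleton.2 ⟨g', by rw [pow_succ]; ring⟩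
    intro D hD f hf
    have hle : N * e c ≤ lengthBound c d ^ c * d :=
      Nat.mul_le_mul hN (hed c (Nat.lt_succ_self c))
    have h1 := hiter (N * e c) D (by simp only [lengthBound] at hD; omega) f hf
    have hsub : J ⊔ Ideal.span {l ^ (N * e c)} ≤ partialIdeal (linearIdeal Λ) G (c + 1) := by
      refine sup_le ?_ ?_
      · rw [partialIdeal_succ]; exact le_sup_left
      · rwa [Ideal.span_singleton_le_iff_mem]
    exact hsub h1

theorem linearIdeal_bot : linearIdeal (⊥ : Submodule k (Fin n → k)) = ⊥ := by
  simp [linearIdeal]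

/-- A homogeneous regular sequence can be completed by generic linear forms. -/
theorem exists_linearForms_regularMod [Infinite k] {c : ℕ} {G : ℕ → MvPolynomial (Fin n) k}
    {e : ℕ → ℕ} (hG : ∀ j < c, (G j).IsHomogeneous (e j)) (he : ∀ j < c, 0 < e j)
    (hreg : RegularMod ⊥ G c) (s : ℕ) (hs : s + c ≤ n) :
    ∃ (Λ : Submodule k (Fin n → k)) (a : ℕ → Fin n → k), Module.finrank k Λ = s ∧
      RegularMod (linearIdeal Λ) G c ∧
      partialIdeal (partialIdeal ⊥ G c) (fun j => linearForm k n (a j)) s =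
        partialIdeal (linearIdeal Λ) G c ∧
      RegularMod (partialIdeal ⊥ G c) (fun j => linearForm k n (a j)) s := by
  induction s with
  | zero =>
    refine ⟨⊥, 0, finrank_bot _ _, by rwa [linearIdeal_bot], ?_, fun j hj => absurd hj (by omega)⟩
    rw [partialIdeal_zero, linearIdeal_bot]
  | succ s ih =>
    obtain ⟨Λ, a, hΛ, hΛG, hpart, hl⟩ := ih (by omega)
    obtain ⟨v, hv⟩ := exists_linearForm_nonZeroDivisorMod
      (fun j : Fin (c + 1) => partialIdeal (linearIdeal Λ) G j)
      (fun j => socleFree_of_regularMod j Λ G (by omega) (hΛG.mono (by omega)))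
    have hvc := hv ⟨c, Nat.lt_succ_self c⟩
    set a' : ℕ → Fin n → k := Function.update a s v
    have ha' : ∀ j < s, a' j = a j := fun j hj => Function.update_of_ne hj.ne _ _
    have has : a' s = v := Function.update_self _ _ _
    have hpart' : ∀ j ≤ s, partialIdeal (partialIdeal ⊥ G c) (fun j => linearForm k n (a' j)) j =
        partialIdeal (partialIdeal ⊥ G c) (fun j => linearForm k n (a j)) j := by
      intro j hj
      rw [partialIdeal, partialIdeal]
      congr 2
      refine Set.image_congr fun i hi => ?_
      rw [ha' i (lt_of_lt_of_le hi hj)]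
    refine ⟨Λ ⊔ Submodule.span k {v}, a', ?_, ?_, ?_, fun j hj => ?_⟩
    · rw [finrank_sup_span_singleton_eq hG he hvc, hΛ]
    · rw [linearIdeal_sup_span]
      exact hΛG.sup_span_singleton fun j hj => hv ⟨j, Nat.lt_succ_of_le hj⟩
    · rw [partialIdeal_succ, hpart' s le_rfl, hpart, has, linearIdeal_sup_span, partialIdeal_sup]
    · rw [hpart' j (by omega)]
      rcases Nat.lt_succ_iff_lt_or_eq.1 hj with hj | rfl
      · simpa only [ha' j hj] using hl j hj
      · rw [hpart]
        simpa only [has] using hvc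

/-- The result over an infinite field, where the sequence is completed by generic linear forms; a
nonzero polynomial in these is a nonzerodivisor modulo the sequence. -/
theorem exists_bounded_annihilator_of_infinite [Infinite k] {c d : ℕ}
    {G : ℕ → MvPolynomial (Fin n) k} {e : ℕ → ℕ} (hG : ∀ j < c, (G j).IsHomogeneous (e j))
    (he : ∀ j < c, 0 < e j) (hed : ∀ j < c, e j ≤ d) (hreg : RegularMod ⊥ G c)
    {h : MvPolynomial (Fin n) k} {eh : ℕ} (hh : h.IsHomogeneous eh) (hehd : eh ≤ d)
    (hzd : ¬ NonZeroDivisorMod (partialIdeal ⊥ G c) h) :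
    ∃ D ≤ lengthBound c d ^ c * d, ∃ u : MvPolynomial (Fin n) k, u.IsHomogeneous D ∧
      u ∉ partialIdeal ⊥ G c ∧ h * u ∈ partialIdeal ⊥ G c := by
  by_cases hcn : c ≤ n
  · obtain ⟨Λ, a, hΛ, hΛG, hpart, hl⟩ := exists_linearForms_regularMod hG he hreg (n - c) (by omega)
    have hb := mem_partialIdeal_of_lengthBound_le d c Λ G e (by omega) hG he hed hΛG
    obtain ⟨y, hy⟩ := exists_sup_span_range_eq_top (Λ := Λ) (q := c) (by omega)
    have hJ : HasComponents (partialIdeal ⊥ G c) := by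
      rw [← linearIdeal_bot]
      exact (hasComponents_linearIdeal ⊥).partialIdeal hG
    have halt := exists_annihilator_or_exists_multiple hJ (m := n - c)
      (l := fun j => linearForm k n (a j))
      (fun j => linearForm_isHomogeneous (a j)) (fun j => linearForm_isHomogeneous (y j))
      (by rw [hpart]; exact X_mem_span_sup hy (le_partialIdeal c))
      (by rw [hpart]; exact hb) hh
    obtain ⟨D, hD, u, hu⟩ | ⟨N, hN, p, hp0, -, hpJ⟩ := halt
    · exact ⟨D, hD.trans (Nat.mul_le_mul_left _ hehd), u, hu⟩
    · exfalso
      apply hzd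
      intro w hw
      refine nonZeroDivisorMod_aeval hJ (fun j _ => linearForm_isHomogeneous (a j))
        (fun _ _ => one_pos) hl hp0 w ?_
      obtain ⟨x, hx, z, hz, hxz⟩ := Submodule.mem_sup.1 hpJ
      obtain ⟨g, rfl⟩ := Ideal.mem_span_singleton.1 hz
      rw [← hxz, add_mul, mul_right_comm]
      exact add_mem (Ideal.mul_mem_right _ _ hx) (Ideal.mul_mem_right _ _ hw)
  · -- there is no homogeneous regular sequence of length greater than `n`
    exfalso
    push Not at hcn
    have hn := mem_partialIdeal_of_lengthBound_le d n ⊥ G e (by simp) (fun j hj => hG j (by omega))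
      (fun j hj => he j (by omega)) (fun j hj => hed j (by omega))
      (by rw [linearIdeal_bot]; exact hreg.mono hcn.le)
    have hpow : ∀ D, G n ^ D ∈ partialIdeal ⊥ G n → 1 ∈ partialIdeal ⊥ G n := by
      intro D
      induction D with
      | zero => simp
      | succ D ih => exact fun h => ih (hreg n hcn _ (by rwa [pow_succ'] at h))
    rw [linearIdeal_bot] at hn
    have h1 := hpow _ (hn (e n * lengthBound n d) (Nat.le_mul_of_pos_left _ (he n hcn)) _
      ((hG n hcn).pow _))
    have h2 := partialIdeal_ne_top (Λ := (⊥ : Submodule k (Fin n → k))) (c := n)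
      (fun j hj => hG j (by omega)) (fun j hj => he j (by omega))
    rw [linearIdeal_bot] at h2
    exact h2 ((Ideal.eq_top_iff_one _).2 h1)

end BoundedZeroDivisors

/-! ### Extension of the field of coefficients -/

section Descent

variable {k k' σ : Type*} [Field k] [Field k'] [Algebra k k']

/-- Apply a linear form to every coefficient of a polynomial. -/
noncomputable def mapCoeffs (l : k' →ₗ[k] k) : MvPolynomial σ k' →+ MvPolynomial σ k where
  toFun x := ∑ μ ∈ x.support, monomial μ (l (coeff μ x))
  map_zero' := by simp
  map_add' x y := by
    classical
    ext ν
    have h : ∀ x : MvPolynomial σ k',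
        coeff ν (∑ μ ∈ x.support, monomial μ (l (coeff μ x))) = l (coeff ν x) := fun x => by
      simp only [coeff_sum, coeff_monomial, Finset.sum_ite_eq']
      split_ifs with hν
      · rfl
      · rw [notMem_support_iff.1 hν, map_zero]
    rw [coeff_add, h, h, h, coeff_add, map_add]

theorem coeff_mapCoeffs (l : k' →ₗ[k] k) (x : MvPolynomial σ k') (ν : σ →₀ ℕ) :
    coeff ν (mapCoeffs l x) = l (coeff ν x) := by
  classical
  simp only [mapCoeffs, AddMonoidHom.coe_mk, ZeroHom.coe_mk, coeff_sum, coeff_monomial,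
    Finset.sum_ite_eq']
  split_ifs with hν
  · rfl
  · rw [notMem_support_iff.1 hν, map_zero]

theorem mapCoeffs_map_mul (l : k' →ₗ[k] k) (r : MvPolynomial σ k) (x : MvPolynomial σ k') :
    mapCoeffs l (map (algebraMap k k') r * x) = r * mapCoeffs l x := by
  classical
  ext ν
  rw [coeff_mapCoeffs, coeff_mul, coeff_mul, map_sum]
  refine Finset.sum_congr rfl fun p _ => ?_
  rw [coeff_map, coeff_mapCoeffs, ← Algebra.smul_def, map_smul, smul_eq_mul]

theorem isHomogeneous_mapCoeffs (l : k' →ₗ[k] k) {x : MvPolynomial σ k'} {D : ℕ}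
    (hx : x.IsHomogeneous D) : (mapCoeffs l x).IsHomogeneous D := by
  intro ν hν
  refine hx fun h => hν ?_
  rw [coeff_mapCoeffs, h, map_zero]

variable {I : Ideal (MvPolynomial σ k)}

theorem mapCoeffs_mem (l : k' →ₗ[k] k) {x : MvPolynomial σ k'}
    (hx : x ∈ I.map (map (algebraMap k k'))) : mapCoeffs l x ∈ I := by
  have : ∀ y, mapCoeffs l (y * x) ∈ I := by
    induction hx using Submodule.span_induction with
    | mem x hx =>
      obtain ⟨r, hr, rfl⟩ := hx
      intro y
      rw [mul_comm, mapCoeffs_map_mul]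
      exact Ideal.mul_mem_right _ _ hr
    | zero => intro y; simp
    | add x z _ _ hx hz => intro y; rw [mul_add, map_add]; exact add_mem (hx y) (hz y)
    | smul a x _ hx => intro y; rw [smul_eq_mul, ← mul_assoc]; exact hx _
  simpa using this 1

/-- A polynomial over the larger field is the combination of its images under the coordinate
forms of a basis. -/
theorem mem_map_of_forall_mapCoeffs_mem {x : MvPolynomial σ k'}
    (hx : ∀ l : k' →ₗ[k] k, mapCoeffs l x ∈ I) : x ∈ I.map (map (algebraMap k k')) := by
  classical
  let b := Module.Basis.ofVectorSpace k k'
  let s := x.support.biUnion fun μ => (b.repr (coeff μ x)).support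
  have hsum : x = ∑ i ∈ s, C (b i) * map (algebraMap k k') (mapCoeffs (b.coord i) x) := by
    ext ν
    simp only [coeff_sum, coeff_C_mul, coeff_map, coeff_mapCoeffs, Module.Basis.coord_apply]
    by_cases hν : ν ∈ x.support
    · conv_lhs => rw [← b.linearCombination_repr (coeff ν x), Finsupp.linearCombination_apply]
      rw [Finsupp.sum_of_support_subset _
        (Finset.subset_biUnion_of_mem (fun μ => (b.repr (coeff μ x)).support) hν) _ (by simp)]
      exact Finset.sum_congr rfl fun i _ => by rw [Algebra.smul_def, mul_comm]
    · rw [notMem_support_iff.1 hν]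
      simp
  rw [hsum]
  exact sum_mem fun i _ => Ideal.mul_mem_left _ _ (Ideal.mem_map_of_mem _ (hx _))

variable (k') in
theorem nonZeroDivisorMod_map_iff {h : MvPolynomial σ k} :
    NonZeroDivisorMod (I.map (map (algebraMap k k'))) (map (algebraMap k k') h) ↔
      NonZeroDivisorMod I h := by
  constructor
  · intro H u hu
    obtain ⟨l, hl⟩ := LinearMap.exists_leftInverse_of_injective (Algebra.linearMap k k')
      (LinearMap.ker_eq_bot.2 (algebraMap k k').injective)
    have h1 := mapCoeffs_mem l (H (map (algebraMap k k') u) (by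
      rw [← map_mul]; exact Ideal.mem_map_of_mem _ hu))
    have h2 : mapCoeffs l (map (algebraMap k k') u) = u := by
      ext ν
      rw [coeff_mapCoeffs, coeff_map]
      exact LinearMap.congr_fun hl _
    rwa [h2] at h1
  · intro H u hu
    refine mem_map_of_forall_mapCoeffs_mem fun l => H _ ?_
    rw [← mapCoeffs_map_mul]
    exact mapCoeffs_mem l hu

theorem map_partialIdeal {R S : Type*} [CommRing R] [CommRing S] (f : R →+* S) (I : Ideal R)
    (G : ℕ → R) (j : ℕ) :
    (partialIdeal I G j).map f = partialIdeal (I.map f) (fun i => f (G i)) j := by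
  rw [partialIdeal, partialIdeal, Ideal.map_sup, Ideal.map_span, Set.image_image]

end Descent

section BoundedAnnihilator

variable {k : Type*} [Field k] {n : ℕ}

/-- A form which is a zero divisor modulo a homogeneous regular sequence is killed by a form of
degree bounded in terms of the length of the sequence and of the degrees involved only. -/
theorem exists_bounded_annihilator {c d : ℕ}
    {G : ℕ → MvPolynomial (Fin n) k} {e : ℕ → ℕ} (hG : ∀ j < c, (G j).IsHomogeneous (e j))
    (he : ∀ j < c, 0 < e j) (hed : ∀ j < c, e j ≤ d) (hreg : RegularMod ⊥ G c)
    {h : MvPolynomial (Fin n) k} {eh : ℕ} (hh : h.IsHomogeneous eh) (hehd : eh ≤ d)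
    (hzd : ¬ NonZeroDivisorMod (partialIdeal ⊥ G c) h) :
    ∃ D ≤ lengthBound c d ^ c * d, ∃ u : MvPolynomial (Fin n) k, u.IsHomogeneous D ∧
      u ∉ partialIdeal ⊥ G c ∧ h * u ∈ partialIdeal ⊥ G c := by
  let φ : MvPolynomial (Fin n) k →+* MvPolynomial (Fin n) (AlgebraicClosure k) :=
    map (algebraMap k (AlgebraicClosure k))
  have : Infinite (AlgebraicClosure k) := IsAlgClosed.instInfinite
  have hpart : ∀ j, partialIdeal ⊥ (fun i => φ (G i)) j = (partialIdeal ⊥ G j).map φ := fun j => by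
    rw [map_partialIdeal, Ideal.map_bot]
  obtain ⟨D, hD, u, hu, huJ, hhu⟩ := exists_bounded_annihilator_of_infinite
    (G := fun i => φ (G i)) (h := φ h) (fun j hj => (hG j hj).map _) he hed
    (fun j hj => by
      rw [hpart]
      exact (nonZeroDivisorMod_map_iff (AlgebraicClosure k)).2 (hreg j hj)) (hh.map _) hehd
    (by
      rw [hpart]
      exact fun h => hzd ((nonZeroDivisorMod_map_iff (AlgebraicClosure k)).1 h))
  rw [hpart] at huJ hhu
  obtain ⟨l, hl⟩ := not_forall.1 fun H => huJ (mem_map_of_forall_mapCoeffs_mem H)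
  refine ⟨D, hD, mapCoeffs l u, isHomogeneous_mapCoeffs l hu, hl, ?_⟩
  rw [← mapCoeffs_map_mul]
  exact mapCoeffs_mem l hhu

end BoundedAnnihilator

/-! ### Ultraproducts of rings -/

section Ultraproduct

open Filter

variable {ι : Type} (R : ι → Type u) [∀ i, CommRing (R i)] (U : Ultrafilter ι)

/-- The ideal of families which vanish `U`-almost everywhere. -/
def ultraIdeal : Ideal (∀ i, R i) where
  carrier := {x | ∀ᶠ i in U, x i = 0}
  zero_mem' := Eventually.of_forall fun _ => rfl
  add_mem' {x y} hx hy := by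
    filter_upwards [hx, hy] with i h1 h2
    rw [Pi.add_apply, h1, h2, add_zero]
  smul_mem' c x hx := by
    filter_upwards [hx] with i h1
    rw [smul_eq_mul, Pi.mul_apply, h1, mul_zero]

/-- The ultraproduct of a family of rings. -/
def Ultraproduct : Type u := (∀ i, R i) ⧸ ultraIdeal R U

namespace Ultraproduct

noncomputable instance : CommRing (Ultraproduct R U) := Ideal.Quotient.commRing (ultraIdeal R U)

variable {R}

/-- The class of a family in the ultraproduct. -/
noncomputable def mk : (∀ i, R i) →+* Ultraproduct R U := Ideal.Quotient.mk (ultraIdeal R U)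

theorem mk_surjective : Function.Surjective (mk (R := R) U) := Ideal.Quotient.mk_surjective

variable {U}

theorem mk_eq_zero {x : ∀ i, R i} : mk U x = 0 ↔ ∀ᶠ i in U, x i = 0 :=
  Ideal.Quotient.eq_zero_iff_mem

theorem mk_eq_mk {x y : ∀ i, R i} : mk U x = mk U y ↔ ∀ᶠ i in U, x i = y i := by
  rw [← sub_eq_zero, ← map_sub, mk_eq_zero]
  simp only [Pi.sub_apply, sub_eq_zero]

instance [∀ i, Nontrivial (R i)] : Nontrivial (Ultraproduct R U) :=
  ⟨⟨mk U 1, mk U 0, fun h => by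
    obtain ⟨i, hi⟩ := (mk_eq_mk.1 h).exists
    exact one_ne_zero hi⟩⟩

instance [∀ i, IsReduced (R i)] : IsReduced (Ultraproduct R U) := by
  constructor
  rintro x ⟨m, hm⟩
  obtain ⟨x, rfl⟩ := mk_surjective U x
  rw [← map_pow, mk_eq_zero] at hm
  refine mk_eq_zero.2 (hm.mono fun i hi => ?_)
  exact eq_zero_of_pow_eq_zero hi

variable {S : ι → Type u} [∀ i, CommRing (S i)]

/-- The ring homomorphism of ultraproducts induced by a family of ring homomorphisms. -/
noncomputable def map (f : ∀ i, R i →+* S i) : Ultraproduct R U →+* Ultraproduct S U :=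
  Ideal.Quotient.lift (ultraIdeal R U)
    ((mk U).comp (RingHom.pi fun i => (f i).comp (Pi.evalRingHom R i))) fun x hx => by
      refine mk_eq_zero.2 (Eventually.mono hx fun i hi => ?_)
      change f i (x i) = 0
      rw [hi, map_zero]

theorem exists_mul_eq_one {k : ι → Type u} [∀ i, Field (k i)] {x : Ultraproduct k U}
    (hx : x ≠ 0) : ∃ y, x * y = 1 := by
  classical
  obtain ⟨x, rfl⟩ := mk_surjective U x
  refine ⟨mk U fun i => (x i)⁻¹, ?_⟩
  have h : ∀ᶠ i in U, ¬ x i = 0 := Ultrafilter.eventually_not.2 fun h => hx (mk_eq_zero.2 h)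
  rw [← map_mul, ← map_one (mk U), mk_eq_mk]
  exact h.mono fun i hi => mul_inv_cancel₀ hi

noncomputable instance {k : ι → Type u} [∀ i, Field (k i)] : Field (Ultraproduct k U) :=
  letI : IsField (Ultraproduct k U) :=
    { exists_pair_ne := exists_pair_ne _
      mul_comm := mul_comm
      mul_inv_cancel := exists_mul_eq_one }
  this.toField

/-- In an ultraproduct of perfect fields of characteristic `p`, every element is a `p`-th power. -/
theorem exists_pow_eq {k : ι → Type u} [∀ i, Field (k i)] [∀ i, PerfectField (k i)] {p : ℕ}
    (hp : p.Prime) [CharP (Ultraproduct k U) p] (c : Ultraproduct k U) : ∃ b, b ^ p = c := by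
  classical
  obtain ⟨a, rfl⟩ := mk_surjective U c
  have hp0 : ∀ᶠ i in U, ((p : ∀ i, k i) i) = 0 := by
    rw [← mk_eq_zero, map_natCast, CharP.cast_eq_zero]
  refine ⟨mk U fun i => if h : ∃ b, b ^ p = a i then h.choose else 0, ?_⟩
  rw [← map_pow, mk_eq_mk]
  filter_upwards [hp0] with i hi
  have h : ∃ b, b ^ p = a i := by
    have : Fact p.Prime := ⟨hp⟩
    have : CharP (k i) p := (CharP.charP_iff_prime_eq_zero hp).2 hi
    have := PerfectField.toPerfectRing (K := k i) p
    exact surjective_frobenius (k i) p (a i)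
  simp only [Pi.pow_apply, dif_pos h]
  exact h.choose_spec

end Ultraproduct

end Ultraproduct

/-! ### Ultraproducts of polynomial rings -/

section Translation

variable {k σ : Type*} [Field k]

/-- A translation only adds terms of lower degree to a form. -/
theorem coeff_aeval_X_add_C_sub_eq_zero (a : σ → k) {d : ℕ} {f : MvPolynomial σ k}
    (hf : f.IsHomogeneous d) {ν : σ →₀ ℕ} (hν : d ≤ ν.degree) :
    coeff ν (aeval (fun i => X i + C (a i)) f - f) = 0 := by
  classical
  set τ : MvPolynomial σ k →ₐ[k] MvPolynomial σ k := aeval fun i => X i + C (a i) with hτ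
  have hmon : ∀ (d : ℕ) (μ : σ →₀ ℕ), μ.degree = d → ∀ ν : σ →₀ ℕ, d ≤ ν.degree →
      coeff ν (τ (monomial μ 1) - monomial μ 1) = 0 := by
    intro d
    induction d with
    | zero =>
      intro μ hμ ν _
      rw [Finsupp.degree_eq_zero_iff] at hμ
      subst hμ
      have : (monomial (0 : σ →₀ ℕ)) (1 : k) = 1 := rfl
      rw [this, map_one, sub_self, coeff_zero]
    | succ d ih =>
      intro μ hμ ν hν
      have hμ0 : μ ≠ 0 := by rintro rfl; simp at hμ
      obtain ⟨i, hi⟩ := Finsupp.ne_iff.1 hμ0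
      have hsplit : Finsupp.single i 1 + (μ - Finsupp.single i 1) = μ :=
        add_tsub_cancel_of_le (by simpa using Nat.one_le_iff_ne_zero.2 hi)
      generalize μ - Finsupp.single i 1 = μ' at hsplit
      subst hsplit
      have hdeg : μ'.degree = d := by
        rw [map_add, Finsupp.degree_single] at hμ
        omega
      have h1 : monomial (Finsupp.single i 1 + μ') (1 : k) = X i * monomial μ' 1 := by
        rw [X, monomial_mul, one_mul]
      have h2 : τ (X i) = X i + C (a i) := aeval_X _ _
      have h3 : τ (X i * monomial μ' 1) - X i * monomial μ' 1 =
          X i * (τ (monomial μ' 1) - monomial μ' 1) +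
            C (a i) * ((τ (monomial μ' 1) - monomial μ' 1) + monomial μ' 1) := by
        rw [map_mul, h2]; ring
      rw [h1, h3, coeff_add, coeff_C_mul, coeff_add, ih μ' hdeg ν (by omega), coeff_monomial,
        if_neg (by rintro rfl; omega), add_zero, mul_zero, add_zero, coeff_X_mul']
      split_ifs with hiν
      · refine ih μ' hdeg _ ?_
        have h4 : Finsupp.single i 1 + (ν - Finsupp.single i 1) = ν :=
          add_tsub_cancel_of_le (by
            simpa using Nat.one_le_iff_ne_zero.2 (Finsupp.mem_support_iff.1 hiν))
        rw [← h4, map_add, Finsupp.degree_single] at hν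
        omega
      · rfl
  rw [f.as_sum, map_sum, ← Finset.sum_sub_distrib, coeff_sum]
  refine Finset.sum_eq_zero fun μ hμ => ?_
  have hμd : μ.degree = d := by
    by_contra h
    exact mem_support_iff.1 hμ (hf.coeff_eq_zero h)
  rw [← mul_one (coeff μ f), ← smul_eq_mul, ← smul_monomial, map_smul, ← smul_sub, coeff_smul,
    hmon d μ hμd ν hν, smul_zero]

/-- A form of positive degree invariant under all translations vanishes: its restrictions to the
hyperplanes `X i = 1` and `X i = 0` agree. The latter is homogeneous of the same degree, whereas
each term of `f` involving `X i` contributes a term of lower degree to the former. -/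
theorem eq_zero_of_forall_translation {d : ℕ} (hd : 0 < d) {f : MvPolynomial σ k}
    (hf : f.IsHomogeneous d) (h : ∀ a : σ → k, aeval (fun i => X i + C (a i)) f = f) : f = 0 := by
  classical
  by_contra hf0
  obtain ⟨μ, hμ⟩ := MvPolynomial.ne_zero_iff.1 hf0
  have hdeg : ∀ ν, coeff ν f ≠ 0 → ν.degree = d := fun ν hν => by
    by_contra h
    exact hν (hf.coeff_eq_zero h)
  have hμ0 : μ ≠ 0 := by
    rintro rfl
    have := hdeg 0 hμ
    simp at this
    omega
  obtain ⟨i, hi⟩ := Finsupp.ne_iff.1 hμ0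
  rw [Finsupp.zero_apply] at hi
  let e : k → MvPolynomial σ k →ₐ[k] MvPolynomial σ k := fun c => aeval (Function.update X i (C c))
  have herase : ∀ ν : σ →₀ ℕ, (ν.erase i).degree + ν i = ν.degree := fun ν => by
    conv_rhs => rw [← Finsupp.erase_add_single i ν, map_add, Finsupp.degree_single]
  have h01 : e 0 f = e 1 f := by
    conv_lhs => rw [← h (Pi.single i 1), ← AlgHom.comp_apply]
    congr 1
    refine algHom_ext fun j => ?_
    rw [AlgHom.comp_apply, aeval_X, map_add, aeval_X, aeval_X, algHom_C, MvPolynomial.algebraMap_eq]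
    by_cases hj : j = i
    · subst hj; simp
    · simp [hj]
  have hmon : ∀ (ν : σ →₀ ℕ) (c : k), e 1 (monomial ν c) = monomial (ν.erase i) c := fun ν c => by
    conv_lhs => rw [← Finsupp.erase_add_single i ν, ← mul_one c, ← monomial_mul]
    rw [map_mul, aeval_monomial, aeval_monomial, MvPolynomial.algebraMap_eq,
      Finsupp.prod_single_index (h := fun j m => Function.update X i (C (1 : k)) j ^ m)
        (pow_zero _), Function.update_self, C_1, one_pow, mul_one, mul_one,
      monomial_eq]
    congr 1
    refine Finsupp.prod_congr fun j hj => ?_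
    rw [Function.update_of_ne]
    rintro rfl
    simp at hj
  have h1 : coeff (μ.erase i) (e 1 f) = coeff μ f := by
    conv_lhs => rw [f.as_sum, map_sum, coeff_sum]
    simp only [hmon, coeff_monomial]
    rw [Finset.sum_eq_single μ]
    · simp
    · intro ν hν hνμ
      refine if_neg fun he => hνμ ?_
      have h2 := herase ν
      have h3 := herase μ
      rw [hdeg ν (mem_support_iff.1 hν)] at h2
      rw [hdeg μ hμ] at h3
      rw [← Finsupp.erase_add_single i ν, ← Finsupp.erase_add_single i μ, he]
      congr 2
      rw [he] at h2
      omega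
    · intro hμ'
      exact absurd (notMem_support_iff.1 hμ') hμ
  have h0 : (e 0 f).IsHomogeneous d := by
    have := hf.aeval (Function.update X i (C (0 : k))) (fun j => by
      by_cases hj : j = i
      · subst hj; simp [isHomogeneous_zero]
      · simpa [hj] using isHomogeneous_X k j)
    rwa [one_mul] at this
  rw [← h1, ← h01] at hμ
  have h2 : (μ.erase i).degree = d := by
    by_contra h
    exact hμ (h0.coeff_eq_zero h)
  have h3 := herase μ
  rw [h01, h1] at hμ
  rw [hdeg μ hμ] at h3
  omega

end Translation

section UltraPoly

open Filter

variable (k : ℕ → Type u) [∀ i, Field (k i)] (n : ℕ → ℕ) (U : Ultrafilter ℕ)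

/-- The ultraproduct of the polynomial rings in `n i` variables over `k i`. -/
def UltraPoly : Type u := Ultraproduct (fun i => MvPolynomial (Fin (n i)) (k i)) U

namespace UltraPoly

noncomputable instance : CommRing (UltraPoly k n U) :=
  inferInstanceAs (CommRing (Ultraproduct (fun i => MvPolynomial (Fin (n i)) (k i)) U))

instance : Nontrivial (UltraPoly k n U) :=
  inferInstanceAs (Nontrivial (Ultraproduct (fun i => MvPolynomial (Fin (n i)) (k i)) U))

instance : IsReduced (UltraPoly k n U) :=
  inferInstanceAs (IsReduced (Ultraproduct (fun i => MvPolynomial (Fin (n i)) (k i)) U))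

variable {k n}

/-- The class of a family of polynomials. -/
noncomputable def mk : (∀ i, MvPolynomial (Fin (n i)) (k i)) →+* UltraPoly k n U :=
  Ultraproduct.mk U

variable {U}

theorem mk_surjective : Function.Surjective (mk (k := k) (n := n) U) := Ultraproduct.mk_surjective U

theorem mk_eq_zero {x : ∀ i, MvPolynomial (Fin (n i)) (k i)} :
    mk U x = 0 ↔ ∀ᶠ i in U, x i = 0 := Ultraproduct.mk_eq_zero

theorem mk_eq_mk {x y : ∀ i, MvPolynomial (Fin (n i)) (k i)} :
    mk U x = mk U y ↔ ∀ᶠ i in U, x i = y i := Ultraproduct.mk_eq_mk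

noncomputable instance : Algebra (Ultraproduct k U) (UltraPoly k n U) :=
  (Ultraproduct.map fun i => (C : k i →+* MvPolynomial (Fin (n i)) (k i))).toAlgebra

theorem algebraMap_mk (a : ∀ i, k i) :
    algebraMap (Ultraproduct k U) (UltraPoly k n U) (Ultraproduct.mk U a) =
      mk U fun i => C (a i) := rfl

theorem smul_mk (a : ∀ i, k i) (x : ∀ i, MvPolynomial (Fin (n i)) (k i)) :
    Ultraproduct.mk U a • mk U x = mk U fun i => C (a i) * x i := by
  rw [Algebra.smul_def, algebraMap_mk, ← map_mul]
  rfl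

variable (k n U)

/-- The classes of families of forms of degree `d`. -/
noncomputable def forms (d : ℕ) : Submodule (Ultraproduct k U) (UltraPoly k n U) where
  carrier := {q | ∃ x, (∀ i, (x i).IsHomogeneous d) ∧ mk U x = q}
  zero_mem' := ⟨0, fun _ => isHomogeneous_zero _ _ _, map_zero _⟩
  add_mem' := by
    rintro _ _ ⟨x, hx, rfl⟩ ⟨y, hy, rfl⟩
    exact ⟨x + y, fun i => (hx i).add (hy i), map_add _ _ _⟩
  smul_mem' := by
    rintro c _ ⟨x, hx, rfl⟩
    obtain ⟨a, rfl⟩ := Ultraproduct.mk_surjective U c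
    refine ⟨_, fun i => ?_, (smul_mk a x).symm⟩
    simpa using (isHomogeneous_C _ (a i)).mul (hx i)

variable {k n U}

theorem mem_forms {d : ℕ} {q : UltraPoly k n U} :
    q ∈ forms k n U d ↔ ∃ x, (∀ i, (x i).IsHomogeneous d) ∧ mk U x = q := Iff.rfl

theorem mk_mem_forms {d : ℕ} {x : ∀ i, MvPolynomial (Fin (n i)) (k i)}
    (hx : ∀ i, (x i).IsHomogeneous d) : mk U x ∈ forms k n U d := ⟨x, hx, rfl⟩

theorem isConnectedGrading_forms : IsConnectedGrading (forms k n U) where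
  zero_le := by
    rintro _ ⟨x, hx, rfl⟩
    refine Submodule.mem_one.2 ⟨Ultraproduct.mk U fun i => coeff 0 (x i), ?_⟩
    rw [algebraMap_mk]
    congr 1
    funext i
    exact (totalDegree_eq_zero_iff_eq_C.1 (Nat.le_zero.1 (hx i).totalDegree_le)).symm
  one_mem := ⟨1, fun i => isHomogeneous_one _ _, map_one _⟩
  mul_mem := by
    rintro a b _ _ ⟨x, hx, rfl⟩ ⟨y, hy, rfl⟩
    exact ⟨x * y, fun i => (hx i).mul (hy i), map_mul _ _ _⟩
  indep := by
    intro N q hq hsum j hj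
    choose x hx hxq using hq
    simp only [← hxq] at hsum
    rw [← map_sum, mk_eq_zero] at hsum
    rw [← hxq, mk_eq_zero]
    filter_upwards [hsum] with i hi
    rw [Finset.sum_apply] at hi
    have := congrArg (homogeneousComponent j) hi
    rw [map_sum, map_zero, Finset.sum_eq_single j] at this
    · rwa [homogeneousComponent_eq_self (hx j i)] at this
    · intro l _ hl
      rw [homogeneousComponent_of_mem (hx l i), if_neg (Ne.symm hl)]
    · intro h
      exact absurd (Finset.mem_range.2 hj) h

/-- The endomorphism induced by a family of translations. -/
noncomputable def translation (a : ∀ i, Fin (n i) → k i) :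
    UltraPoly k n U →ₐ[Ultraproduct k U] UltraPoly k n U where
  toRingHom := Ultraproduct.map fun i => (aeval fun j => X j + C (a i j) :
    MvPolynomial (Fin (n i)) (k i) →ₐ[k i] MvPolynomial (Fin (n i)) (k i)).toRingHom
  commutes' c := by
    obtain ⟨c, rfl⟩ := Ultraproduct.mk_surjective U c
    rw [algebraMap_mk]
    change Ultraproduct.mk U _ = Ultraproduct.mk U _
    congr 1
    funext i
    exact AlgHom.commutes (aeval fun j => X j + C (a i j) :
      MvPolynomial (Fin (n i)) (k i) →ₐ[k i] MvPolynomial (Fin (n i)) (k i)) (c i)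

theorem translation_mk (a : ∀ i, Fin (n i) → k i) (x : ∀ i, MvPolynomial (Fin (n i)) (k i)) :
    translation a (mk U x) = mk U fun i => aeval (fun j => X j + C (a i j)) (x i) := rfl

theorem translation_sub_mem (a : ∀ i, Fin (n i) → k i) (d : ℕ) {q : UltraPoly k n U}
    (hq : q ∈ forms k n U d) : translation a q - q ∈ below (forms k n U) d := by
  obtain ⟨x, hx, rfl⟩ := hq
  let y : ∀ i, MvPolynomial (Fin (n i)) (k i) := fun i =>
    aeval (fun j => X j + C (a i j)) (x i) - x i
  have hy : translation a (mk U x) - mk U x = mk U y := by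
    rw [translation_mk, ← map_sub]; rfl
  have hsum : y = ∑ j ∈ Finset.range d, fun i => homogeneousComponent j (y i) := by
    funext i
    rw [Finset.sum_apply]
    ext ν
    rw [coeff_sum]
    simp only [coeff_homogeneousComponent]
    rw [Finset.sum_ite_eq]
    split_ifs with hν
    · rfl
    · exact coeff_aeval_X_add_C_sub_eq_zero (a i) (hx i) (by simpa using hν)
  rw [hy, hsum, map_sum]
  refine sum_mem fun j hj => ?_
  exact Submodule.mem_iSup_of_mem (⟨j, Finset.mem_range.1 hj⟩ : Fin d)
    (mk_mem_forms fun i => homogeneousComponent_isHomogeneous _ _)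

theorem eq_zero_of_forall_translation {d : ℕ} (hd : 0 < d) {q : UltraPoly k n U}
    (hq : q ∈ forms k n U d) (h : ∀ a, translation a q = q) : q = 0 := by
  classical
  obtain ⟨x, hx, rfl⟩ := hq
  let a : ∀ i, Fin (n i) → k i := fun i =>
    if h : ∃ a : Fin (n i) → k i, aeval (fun j => X j + C (a j)) (x i) ≠ x i then h.choose else 0
  have h1 := h a
  rw [translation_mk, mk_eq_mk] at h1
  rw [mk_eq_zero]
  filter_upwards [h1] with i hi
  refine _root_.eq_zero_of_forall_translation hd (hx i) ?_
  by_contra hne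
  have hne' := not_forall.1 hne
  simp only [a, dif_pos hne'] at hi
  exact hne'.choose_spec hi

/-- The algebra of classes of families of forms is a polynomial algebra. -/
theorem aeval_injective [∀ i, PerfectField (k i)] {E : Type u} {w : E → ℕ} {v : E → UltraPoly k n U}
    (hv : IsMinimalGenerators (forms k n U) w v) :
    Function.Injective (aeval v : MvPolynomial E (Ultraproduct k U) →ₐ[Ultraproduct k U] _) :=
  _root_.aeval_injective (fun p hp _ c => Ultraproduct.exists_pow_eq hp c)
    isConnectedGrading_forms hv (Set.range fun a => translation a)
    (by rintro _ ⟨a, rfl⟩ d x hx; exact translation_sub_mem a d hx)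
    (fun d hd x hx h => eq_zero_of_forall_translation hd hx fun a => h _ ⟨a, rfl⟩)

end UltraPoly

end UltraPoly

/-! ### Small subalgebras -/

section Lifting

theorem mem_partialIdeal_bot_iff {R : Type*} [CommRing R] {G : ℕ → R} {c : ℕ} {x : R} :
    x ∈ partialIdeal ⊥ G c ↔ ∃ a : ℕ → R, ∑ j ∈ Finset.range c, a j * G j = x := by
  constructor
  · intro hx
    induction c generalizing x with
    | zero =>
      rw [partialIdeal_zero] at hx
      exact ⟨0, by simpa using hx.symm⟩
    | succ c ih =>
      rw [partialIdeal_succ] at hx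
      obtain ⟨y, hy, z, hz, rfl⟩ := Submodule.mem_sup.1 hx
      obtain ⟨a, rfl⟩ := ih hy
      obtain ⟨b, rfl⟩ := Ideal.mem_span_singleton'.1 hz
      refine ⟨Function.update a c b, ?_⟩
      rw [Finset.sum_range_succ, Function.update_self]
      congr 1
      refine Finset.sum_congr rfl fun j hj => ?_
      rw [Function.update_of_ne (Finset.mem_range.1 hj).ne]
  · rintro ⟨a, rfl⟩
    exact sum_mem fun j hj => Ideal.mul_mem_left _ _ (mem_partialIdeal (Finset.mem_range.1 hj))

/-- A form in the ideal of finitely many forms is a combination of them with forms as coefficients.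
The coefficients of those of degree greater than `D` vanish, so that the truncation of `D - e j` is
harmless. -/
theorem exists_isHomogeneous_sum_eq {k : Type*} [Field k] {n : ℕ} {G : ℕ → MvPolynomial (Fin n) k}
    {e : ℕ → ℕ} {c : ℕ} (hG : ∀ j, (G j).IsHomogeneous (e j)) {x : MvPolynomial (Fin n) k} {D : ℕ}
    (hx : x.IsHomogeneous D) (hxG : x ∈ partialIdeal ⊥ G c) :
    ∃ a : ℕ → MvPolynomial (Fin n) k, (∀ j, (a j).IsHomogeneous (D - e j)) ∧
      ∑ j ∈ Finset.range c, a j * G j = x := by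
  obtain ⟨a, ha⟩ := mem_partialIdeal_bot_iff.1 hxG
  refine ⟨fun j => if e j ≤ D then homogeneousComponent (D - e j) (a j) else 0, fun j => ?_, ?_⟩
  · dsimp only
    split_ifs
    · exact homogeneousComponent_isHomogeneous _ _
    · exact isHomogeneous_zero _ _ _
  · conv_rhs => rw [← homogeneousComponent_eq_self hx, ← ha, map_sum]
    refine Finset.sum_congr rfl fun j _ => ?_
    rw [homogeneousComponent_mul (hG j), ite_mul, zero_mul]

theorem mem_span_X_image_of_X_mul_mem {σ K : Type*} [CommRing K] {s : Set σ} {a : σ} (ha : a ∉ s)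
    {p : MvPolynomial σ K} (hp : X a * p ∈ Ideal.span (X '' s : Set (MvPolynomial σ K))) :
    p ∈ Ideal.span (X '' s : Set (MvPolynomial σ K)) := by
  classical
  rw [mem_ideal_span_X_image] at hp ⊢
  intro m hm
  obtain ⟨i, hi, h⟩ := hp (Finsupp.single a 1 + m) (by
    rw [mem_support_iff, coeff_X_mul]; exact mem_support_iff.1 hm)
  refine ⟨i, hi, ?_⟩
  have hai : a ≠ i := fun h => ha (h ▸ hi)
  simpa [Finsupp.single_apply, hai] using h

end Lifting

namespace UltraPoly

open Filter

variable {k : ℕ → Type u} [∀ i, Field (k i)] {n : ℕ → ℕ} {U : Ultrafilter ℕ}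

theorem eventually_mem_partialIdeal {g : ℕ → ∀ i, MvPolynomial (Fin (n i)) (k i)} {c : ℕ}
    {x : ∀ i, MvPolynomial (Fin (n i)) (k i)}
    (hx : mk U x ∈ partialIdeal ⊥ (fun j => mk U (g j)) c) :
    ∀ᶠ i in U, x i ∈ partialIdeal ⊥ (fun j => g j i) c := by
  obtain ⟨a, ha⟩ := mem_partialIdeal_bot_iff.1 hx
  choose b hb using fun j => mk_surjective (a j)
  simp only [← hb, ← map_mul, ← map_sum] at ha
  filter_upwards [mk_eq_mk.1 ha] with i hi
  refine mem_partialIdeal_bot_iff.2 ⟨fun j => b j i, ?_⟩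
  rw [← hi, Finset.sum_apply]
  rfl

theorem exists_aeval_mk {t : ℕ} (g : Fin t → ∀ i, MvPolynomial (Fin (n i)) (k i))
    (p : MvPolynomial (Fin t) (Ultraproduct k U)) :
    ∃ P : ∀ i, MvPolynomial (Fin t) (k i),
      aeval (fun j => mk U (g j)) p = mk U fun i => aeval (fun j => g j i) (P i) := by
  induction p using MvPolynomial.induction_on with
  | C a =>
    obtain ⟨a, rfl⟩ := Ultraproduct.mk_surjective U a
    refine ⟨fun i => C (a i), ?_⟩
    rw [algHom_C, algebraMap_mk]
    congr 1
    funext i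
    rw [algHom_C, MvPolynomial.algebraMap_eq]
  | add p q hp hq =>
    obtain ⟨P, hP⟩ := hp
    obtain ⟨P', hP'⟩ := hq
    refine ⟨P + P', ?_⟩
    rw [map_add, hP, hP', ← map_add]
    congr 1
    funext i
    exact (map_add _ _ _).symm
  | mul_X p j hp =>
    obtain ⟨P, hP⟩ := hp
    refine ⟨fun i => P i * X j, ?_⟩
    rw [map_mul, hP, aeval_X, ← map_mul]
    congr 1
    funext i
    rw [Pi.mul_apply, map_mul, aeval_X]

/-- Representatives of finitely many generators of the algebra of classes of forms are almost
everywhere a regular sequence: otherwise forms of bounded degree killing one representative modulo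
the preceding ones would define a relation between the variables of a polynomial ring. -/
theorem eventually_regularMod [∀ i, PerfectField (k i)] {E : Type u} {w : E → ℕ}
    {v : E → UltraPoly k n U} (hv : IsMinimalGenerators (forms k n U) w v) {t d : ℕ}
    {ε : Fin t → E} (hε : Function.Injective ε) {g : ℕ → ∀ i, MvPolynomial (Fin (n i)) (k i)}
    {e : ℕ → ℕ} (hg : ∀ j i, (g j i).IsHomogeneous (e j)) (hgv : ∀ j : Fin t, mk U (g j) = v (ε j))
    (he : ∀ j < t, 0 < e j) (hed : ∀ j < t, e j ≤ d) :
    ∀ᶠ i in U, RegularMod ⊥ (fun j => g j i) t := by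
  classical
  suffices h : ∀ c ≤ t, ∀ᶠ i in U, RegularMod ⊥ (fun j => g j i) c from h t le_rfl
  intro c
  induction c with
  | zero => exact fun _ => Eventually.of_forall fun i j hj => absurd hj (Nat.not_lt_zero j)
  | succ c ih =>
    intro hc
    by_contra hreg
    rw [← Ultrafilter.eventually_not] at hreg
    have hann : ∀ᶠ i in U, ∃ D ∈ Set.Iic (lengthBound c d ^ c * d),
        ∃ u : MvPolynomial (Fin (n i)) (k i), u.IsHomogeneous D ∧
          u ∉ partialIdeal ⊥ (fun j => g j i) c ∧
          g c i * u ∈ partialIdeal ⊥ (fun j => g j i) c := by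
      filter_upwards [hreg, ih (Nat.le_of_succ_le hc)] with i hi hi'
      refine exists_bounded_annihilator (fun j _ => hg j i) (fun j hj => he j (by omega))
        (fun j hj => hed j (by omega)) hi' (hg c i) (hed c hc) fun hnz => hi fun j hj => ?_
      rcases Nat.lt_succ_iff_lt_or_eq.1 hj with hj | rfl
      · exact hi' j hj
      · exact hnz
    obtain ⟨D, -, hD⟩ := (Ultrafilter.eventually_exists_mem_iff (Set.finite_Iic _)).1 hann
    -- `u` is a family of annihilators of the same degree, `a` a family of coefficients
    let P : ∀ i, MvPolynomial (Fin (n i)) (k i) → (ℕ → MvPolynomial (Fin (n i)) (k i)) → Prop :=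
      fun i u a => u.IsHomogeneous D ∧ (∀ j, (a j).IsHomogeneous (e c + D - e j))
    have hua : ∀ i, ∃ u a, P i u a ∧ ((∃ u : MvPolynomial (Fin (n i)) (k i), u.IsHomogeneous D ∧
        u ∉ partialIdeal ⊥ (fun j => g j i) c ∧ g c i * u ∈ partialIdeal ⊥ (fun j => g j i) c) →
        u ∉ partialIdeal ⊥ (fun j => g j i) c ∧ ∑ j ∈ Finset.range c, a j * g j i = g c i * u) := by
      intro i
      by_cases h : ∃ u : MvPolynomial (Fin (n i)) (k i), u.IsHomogeneous D ∧
        u ∉ partialIdeal ⊥ (fun j => g j i) c ∧ g c i * u ∈ partialIdeal ⊥ (fun j => g j i) c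
      · obtain ⟨u, hu, hu', hgu⟩ := h
        obtain ⟨a, ha, hau⟩ := exists_isHomogeneous_sum_eq (fun j => hg j i) ((hg c i).mul hu) hgu
        exact ⟨u, a, ⟨hu, ha⟩, fun _ => ⟨hu', hau⟩⟩
      · exact ⟨0, 0, ⟨isHomogeneous_zero _ _ _, fun _ => isHomogeneous_zero _ _ _⟩,
          fun h' => absurd h' h⟩
    choose u a hP hua using hua
    have hu := hD.mono hua
    obtain ⟨p, -, hp⟩ := exists_aeval_eq isConnectedGrading_forms hv D (mk U u)
      (mk_mem_forms fun i => (hP i).1)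
    have hb := fun j => exists_aeval_eq isConnectedGrading_forms hv (e c + D - e j)
      (mk U fun i => a i j) (mk_mem_forms fun i => (hP i).2 j)
    choose b _ hb using hb
    let c' : Fin t := ⟨c, hc⟩
    let ι : Fin c → Fin t := Fin.castLE (Nat.le_of_succ_le hc)
    have hrel : aeval v (X (ε c') * p) = aeval v (∑ j : Fin c, b j * X (ε (ι j))) := by
      rw [map_mul, aeval_X, hp, map_sum, ← hgv, ← map_mul]
      simp only [map_mul, aeval_X, hb, ← hgv]
      simp only [← map_mul, ← map_sum]
      rw [mk_eq_mk]
      filter_upwards [hu] with i hi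
      rw [Pi.mul_apply, ← hi.2, Finset.sum_apply, Finset.sum_range]
      rfl
    let s : Set E := Set.range fun j => ε (ι j)
    have hmem : p ∈ Ideal.span (X '' s : Set (MvPolynomial E (Ultraproduct k U))) := by
      refine mem_span_X_image_of_X_mul_mem (a := ε c') ?_ ?_
      · rintro ⟨j, h⟩
        have := congrArg Fin.val (hε h)
        exact (ne_of_lt j.2) this
      · rw [aeval_injective hv hrel]
        exact sum_mem fun j _ => Ideal.mul_mem_left _ _
          (Ideal.subset_span ⟨_, ⟨j, rfl⟩, rfl⟩)
    have hle : Ideal.span (X '' s : Set (MvPolynomial E (Ultraproduct k U))) ≤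
        (partialIdeal ⊥ (fun j => mk U (g j)) c).comap (aeval v) := by
      rw [Ideal.span_le]
      rintro _ ⟨_, ⟨j, rfl⟩, rfl⟩
      rw [SetLike.mem_coe, Ideal.mem_comap, aeval_X, ← hgv]
      exact mem_partialIdeal (G := fun j => mk U (g j)) j.2
    have hmem' := hle hmem
    rw [Ideal.mem_comap, hp] at hmem'
    obtain ⟨i, hi, hi'⟩ := (hu.and (eventually_mem_partialIdeal hmem')).exists
    exact hi.1 hi'

end UltraPoly

/-- Forms of given degrees lie in the subalgebra generated by a homogeneous regular sequence of
length bounded independently of the perfect field and of the number of variables. The sequence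
consists of the first `t` terms of `g`, which is indexed by `ℕ` for convenience. -/
theorem exists_small_subalgebra (r : ℕ) (d : Fin r → ℕ) :
    ∃ s : ℕ, ∀ (k : Type u) [Field k] [PerfectField k] (n : ℕ)
      (f : Fin r → MvPolynomial (Fin n) k), (∀ i, (f i).IsHomogeneous (d i)) →
      ∃ t ≤ s, ∃ (g : ℕ → MvPolynomial (Fin n) k) (e : ℕ → ℕ),
        (∀ j < t, (g j).IsHomogeneous (e j)) ∧ (∀ j < t, 0 < e j) ∧
        (∀ j < t, e j ≤ Finset.univ.sup d) ∧ RegularMod ⊥ g t ∧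
        ∀ i, f i ∈ Algebra.adjoin k (Set.range fun j : Fin t => g j) := by
  classical
  by_contra! hbad
  choose k hk hperf n f hf hbad using hbad
  let U : Ultrafilter ℕ := Filter.hyperfilter ℕ
  obtain ⟨E, w, v, hv⟩ := exists_isMinimalGenerators (UltraPoly.forms k n U)
  have hF := fun i => exists_aeval_eq UltraPoly.isConnectedGrading_forms hv (d i)
    (UltraPoly.mk U fun s => f s i) (UltraPoly.mk_mem_forms fun s => hf s i)
  choose F hFd hF using hF
  -- the generators which occur in the polynomials expressing the classes of the `f i`
  let V : Finset E := Finset.univ.biUnion fun i => (F i).vars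
  have hVd : ∀ e ∈ V, w e ≤ Finset.univ.sup d := by
    intro e he
    obtain ⟨i, -, hi⟩ := Finset.mem_biUnion.1 he
    obtain ⟨μ, hμ, heμ⟩ := (mem_vars_iff_mem_support e).1 hi
    refine le_trans ?_ (Finset.le_sup (Finset.mem_univ i))
    rw [← hFd i (mem_support_iff.1 hμ)]
    exact Finsupp.le_weight_of_ne_zero' w (Finsupp.mem_support_iff.1 heμ)
  let t := V.card
  let ε : Fin t → E := fun j => V.equivFin.symm j
  have hε : Function.Injective ε := Subtype.val_injective.comp V.equivFin.symm.injective
  have hεV : ∀ e ∈ V, ∃ j, ε j = e := fun e he => ⟨V.equivFin ⟨e, he⟩, by simp [ε]⟩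
  -- they are enumerated by `ℕ`, with zeros from index `t` on
  let e : ℕ → ℕ := fun j => if h : j < t then w (ε ⟨j, h⟩) else 0
  let y : ℕ → UltraPoly k n U := fun j => if h : j < t then v (ε ⟨j, h⟩) else 0
  have hy : ∀ j, y j ∈ UltraPoly.forms k n U (e j) := by
    intro j
    simp only [y, e]
    split_ifs
    · exact hv.mem _
    · exact zero_mem _
  choose g hg hgy using fun j => UltraPoly.mem_forms.1 (hy j)
  have hgv : ∀ j : Fin t, UltraPoly.mk U (g j) = v (ε j) := fun j => by
    rw [hgy]; simp only [y, dif_pos j.2]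
  have he : ∀ j < t, 0 < e j := fun j hj => by
    simp only [e, dif_pos hj]; exact hv.pos _
  have hed : ∀ j < t, e j ≤ Finset.univ.sup d := fun j hj => by
    simp only [e, dif_pos hj]; exact hVd _ (V.equivFin.symm ⟨j, hj⟩).2
  have hreg := UltraPoly.eventually_regularMod hv hε hg hgv he hed
  have hadj : ∀ i, ∀ᶠ s in U, f s i ∈
      Algebra.adjoin (k s) (Set.range fun j : Fin t => g j s) := by
    intro i
    obtain ⟨q, hq⟩ := exists_rename_eq_of_vars_subset_range (F i) ε hε fun x hx =>
      hεV x (Finset.mem_biUnion.2 ⟨i, Finset.mem_univ i, hx⟩)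
    obtain ⟨P, hP⟩ := UltraPoly.exists_aeval_mk (fun j : Fin t => g j) q
    have h1 : UltraPoly.mk U (fun s => f s i) =
        UltraPoly.mk U fun s => aeval (fun j : Fin t => g j s) (P s) := by
      rw [← hF i, ← hq, aeval_rename, ← hP]
      congr 2
      funext j
      exact (hgv j).symm
    filter_upwards [UltraPoly.mk_eq_mk.1 h1] with s hs
    rw [hs, Algebra.adjoin_range_eq_range_aeval]
    exact ⟨P s, rfl⟩
  have hlarge : ∀ᶠ s in U, t ≤ s :=
    (Filter.eventually_ge_atTop t).filter_mono Nat.hyperfilter_le_atTop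
  obtain ⟨s, hs⟩ := (hlarge.and (hreg.and (Filter.eventually_all.2 hadj))).exists
  obtain ⟨i, hi⟩ := hbad s t hs.1 (fun j => g j s) e (fun j _ => hg j s) he hed hs.2.1
  exact hi (hs.2.2 i)

/-! ### Projective dimension over polynomial rings -/

section ProjectiveDimension

open CategoryTheory TensorProduct

theorem hasProjectiveDimensionLE_of_exact {R M N P : Type u} [CommRing R] [AddCommGroup M]
    [Module R M] [AddCommGroup N] [Module R N] [AddCommGroup P] [Module R P] {f : M →ₗ[R] N}
    {g : N →ₗ[R] P} (hf : Function.Injective f) (hg : Function.Surjective g)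
    (hfg : Function.Exact f g) {n : ℕ} (hM : HasProjectiveDimensionLE (ModuleCat.of R M) n)
    (hN : HasProjectiveDimensionLE (ModuleCat.of R N) (n + 1)) :
    HasProjectiveDimensionLE (ModuleCat.of R P) (n + 1) :=
  (ModuleCat.shortComplex_shortExact
    (ModuleCat.shortComplexOfCompEqZero f g hfg.linearMap_comp_eq_zero) hfg hf
      hg).hasProjectiveDimensionLT_X₃ (n + 1) hM hN

theorem hasProjectiveDimensionLE_of_projective (R M : Type u) [CommRing R] [AddCommGroup M]
    [Module R M] [Module.Projective R M] (n : ℕ) :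
    HasProjectiveDimensionLE (ModuleCat.of R M) n := by
  have : HasProjectiveDimensionLT (ModuleCat.of R M) 1 :=
    projective_iff_hasProjectiveDimensionLT_one.1 ((IsProjective.iff_projective M).1 inferInstance)
  exact hasProjectiveDimensionLT_of_ge _ 1 _ (by omega)

theorem hasProjectiveDimensionLE_ker {R M N P : Type u} [CommRing R] [AddCommGroup M]
    [Module R M] [AddCommGroup N] [Module R N] [AddCommGroup P] [Module R P]
    [Module.Projective R N] {f : M →ₗ[R] N}
    {g : N →ₗ[R] P} (hf : Function.Injective f) (hg : Function.Surjective g)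
    (hfg : Function.Exact f g) {n : ℕ}
    (hP : HasProjectiveDimensionLE (ModuleCat.of R P) (n + 1)) :
    HasProjectiveDimensionLE (ModuleCat.of R M) n :=
  (ModuleCat.shortComplex_shortExact
    (ModuleCat.shortComplexOfCompEqZero f g hfg.linearMap_comp_eq_zero) hfg hf
      hg).hasProjectiveDimensionLT_X₁ (n + 1) (hasProjectiveDimensionLE_of_projective R N n) hP

/-- Flat base change does not increase the projective dimension. -/
theorem hasProjectiveDimensionLE_baseChange {A R : Type u} [CommRing A] [CommRing R] [Algebra A R]
    [Module.Flat A R] (n : ℕ) : ∀ (M : Type u) [AddCommGroup M] [Module A M],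
      HasProjectiveDimensionLE (ModuleCat.of A M) n →
      HasProjectiveDimensionLE (ModuleCat.of R (R ⊗[A] M)) n := by
  induction n with
  | zero =>
    intro M _ _ hM
    have h1 : Projective (ModuleCat.of A M) := projective_iff_hasProjectiveDimensionLT_one.2 hM
    have : Module.Projective A M := (IsProjective.iff_projective M).2 h1
    exact hasProjectiveDimensionLE_of_projective _ _ _
  | succ n ih =>
    intro M _ _ hM
    let g : (M →₀ A) →ₗ[A] M := Finsupp.linearCombination A id
    have hg : Function.Surjective g := Finsupp.linearCombination_id_surjective A M
    have hex : Function.Exact (LinearMap.ker g).subtype g := LinearMap.exact_subtype_ker_map g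
    have hK := ih (LinearMap.ker g)
      (hasProjectiveDimensionLE_ker (LinearMap.ker g).injective_subtype hg hex hM)
    refine hasProjectiveDimensionLE_of_exact (f := (LinearMap.ker g).subtype.baseChange R)
      (g := g.baseChange R) ?_ ?_ ?_ hK (hasProjectiveDimensionLE_of_projective _ _ _)
    · exact Module.Flat.lTensor_preserves_injective_linearMap _ (LinearMap.ker g).injective_subtype
    · exact LinearMap.lTensor_surjective R hg
    · exact Module.Flat.lTensor_exact R (N := LinearMap.ker g) (N' := M →₀ A) hex

section Polynomial

open Polynomial

variable {B M : Type u} [CommRing B] [AddCommGroup M] [Module B M]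

variable (B M) in
/-- The coefficient of `X ^ j` in the tensor product, a sum of copies of `M`. -/
noncomputable def tensorCoeff (j : ℕ) : B[X] ⊗[B] M →ₗ[B] M :=
  (TensorProduct.lid B M).toLinearMap ∘ₗ (Polynomial.lcoeff B j).rTensor M

theorem tensorCoeff_tmul (j : ℕ) (p : B[X]) (m : M) :
    tensorCoeff B M j (p ⊗ₜ m) = p.coeff j • m := by
  simp [tensorCoeff]

theorem exists_sum_tensorCoeff (z : B[X] ⊗[B] M) :
    ∃ N, (∀ j ≥ N, tensorCoeff B M j z = 0) ∧
      ∀ N' ≥ N, z = ∑ j ∈ Finset.range N', ((Polynomial.X : B[X]) ^ j) ⊗ₜ tensorCoeff B M j z := by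
  induction z with
  | zero => exact ⟨0, by simp, by simp⟩
  | tmul p m =>
    refine ⟨p.natDegree + 1, fun j hj => ?_, fun N' hN' => ?_⟩
    · rw [tensorCoeff_tmul, Polynomial.coeff_eq_zero_of_natDegree_lt (by omega), zero_smul]
    · simp only [tensorCoeff_tmul, ← TensorProduct.smul_tmul, ← TensorProduct.sum_tmul]
      congr 1
      conv_lhs => rw [Polynomial.as_sum_range' p N' (by omega)]
      exact Finset.sum_congr rfl fun j _ => by
        rw [← Polynomial.C_mul_X_pow_eq_monomial, Polynomial.smul_eq_C_mul]
  | add x y hx hy =>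
    obtain ⟨N, hN, hx⟩ := hx
    obtain ⟨N', hN', hy⟩ := hy
    refine ⟨max N N', fun j hj => ?_, fun L hL => ?_⟩
    · rw [map_add, hN j (le_trans (le_max_left _ _) hj), hN' j (le_trans (le_max_right _ _) hj),
        add_zero]
    · simp only [map_add, TensorProduct.tmul_add, Finset.sum_add_distrib]
      rw [← hx L (le_trans (le_max_left _ _) hL), ← hy L (le_trans (le_max_right _ _) hL)]

variable [Module B[X] M] [IsScalarTower B B[X] M]

variable (B M) in
/-- Multiplication by the difference of the two actions of the variable, on the left factor and on
`M`. Together with `actionMap` it forms a short exact sequence resolving the `B[X]`-module `M` by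
modules extended from `B`. -/
noncomputable def subX : B[X] ⊗[B] M →ₗ[B[X]] B[X] ⊗[B] M :=
  LinearMap.lsmul B[X] _ (Polynomial.X : B[X]) -
    ((LinearMap.lsmul B[X] M (Polynomial.X : B[X])).restrictScalars B).baseChange B[X]

variable (B M) in
/-- The action of polynomials, as a linear map on the tensor product. -/
noncomputable def actionMap : B[X] ⊗[B] M →ₗ[B[X]] M :=
  LinearMap.liftBaseChange B[X] (LinearMap.id : M →ₗ[B] M)

theorem subX_tmul (p : B[X]) (m : M) :
    subX B M (p ⊗ₜ m) = (Polynomial.X * p) ⊗ₜ m - p ⊗ₜ ((Polynomial.X : B[X]) • m) := rfl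

theorem actionMap_tmul (p : B[X]) (m : M) : actionMap B M (p ⊗ₜ m) = p • m := by
  simp [actionMap]

theorem tensorCoeff_succ_subX (j : ℕ) (z : B[X] ⊗[B] M) :
    tensorCoeff B M (j + 1) (subX B M z) =
      tensorCoeff B M j z - (Polynomial.X : B[X]) • tensorCoeff B M (j + 1) z := by
  induction z with
  | zero => simp
  | tmul p m =>
    rw [subX_tmul, map_sub, tensorCoeff_tmul, tensorCoeff_tmul, tensorCoeff_tmul, tensorCoeff_tmul,
      Polynomial.coeff_X_mul, smul_comm]
  | add x y hx hy =>
    rw [map_add, map_add, hx, hy, map_add, map_add, smul_add]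
    abel

theorem subX_injective : Function.Injective (subX B M) := by
  rw [injective_iff_map_eq_zero]
  intro z hz
  obtain ⟨N, hN, hsum⟩ := exists_sum_tensorCoeff z
  -- the coefficients vanish in large degrees, hence in all degrees by descending induction
  have hstep : ∀ j, tensorCoeff B M j z = (Polynomial.X : B[X]) • tensorCoeff B M (j + 1) z :=
    fun j => by
      have := tensorCoeff_succ_subX j z
      rwa [hz, map_zero, eq_comm, sub_eq_zero] at this
  have hzero : ∀ i j, N ≤ j + i → tensorCoeff B M j z = 0 := by
    intro i
    induction i with
    | zero => exact fun j hj => hN j hj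
    | succ i ih => exact fun j hj => by rw [hstep, ih (j + 1) (by omega), smul_zero]
  rw [hsum N le_rfl]
  exact Finset.sum_eq_zero fun j _ => by rw [hzero N j (by omega), TensorProduct.tmul_zero]

theorem actionMap_surjective : Function.Surjective (actionMap B M) := fun m =>
  ⟨1 ⊗ₜ m, by rw [actionMap_tmul, one_smul]⟩

theorem exact_subX_actionMap : Function.Exact (subX B M) (actionMap B M) := by
  rw [LinearMap.exact_iff]
  refine le_antisymm (fun z hz => ?_) ?_
  · -- modulo the image of `subX`, every tensor is of the form `1 ⊗ m`
    have h : ∀ z : B[X] ⊗[B] M, z - 1 ⊗ₜ actionMap B M z ∈ LinearMap.range (subX B M) := by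
      intro z
      induction z with
      | zero => simp
      | tmul p m =>
        rw [actionMap_tmul]
        induction p using Polynomial.induction_on' generalizing m with
        | add p q hp hq =>
          rw [TensorProduct.add_tmul, add_smul, TensorProduct.tmul_add, add_sub_add_comm]
          exact add_mem (hp m) (hq m)
        | monomial i b =>
          induction i generalizing m with
          | zero =>
            have h1 : Polynomial.monomial 0 b = b • (1 : B[X]) := by
              rw [Polynomial.monomial_zero_left, Polynomial.smul_eq_C_mul, mul_one]
            rw [h1, TensorProduct.smul_tmul, smul_assoc, one_smul, sub_self]
            exact zero_mem _
          | succ i ih =>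
            have h1 : Polynomial.monomial (i + 1) b = Polynomial.X * Polynomial.monomial i b := by
              rw [Polynomial.X_mul_monomial]
            have h2 := add_mem (ih ((Polynomial.X : B[X]) • m))
              (LinearMap.mem_range_self (subX B M) (Polynomial.monomial i b ⊗ₜ m))
            rw [subX_tmul, ← h1, smul_smul, mul_comm _ Polynomial.X, ← h1] at h2
            rwa [add_comm, sub_add_sub_cancel] at h2
      | add x y hx hy =>
        rw [map_add, TensorProduct.tmul_add, add_sub_add_comm]
        exact add_mem hx hy
    have := h z
    rwa [LinearMap.mem_ker.1 hz, TensorProduct.tmul_zero, sub_zero] at this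
  · rintro _ ⟨z, rfl⟩
    rw [LinearMap.mem_ker]
    induction z with
    | zero => simp
    | tmul p m =>
      rw [subX_tmul, map_sub, actionMap_tmul, actionMap_tmul, smul_smul, mul_comm, sub_self]
    | add x y hx hy => rw [map_add, map_add, hx, hy, add_zero]

end Polynomial

/-- The syzygy theorem, for one variable. -/
theorem hasProjectiveDimensionLE_polynomial {B : Type u} [CommRing B] {n : ℕ}
    (hB : ∀ (M : Type u) [AddCommGroup M] [Module B M],
      HasProjectiveDimensionLE (ModuleCat.of B M) n)
    (M : Type u) [AddCommGroup M] [Module (Polynomial B) M] :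
    HasProjectiveDimensionLE (ModuleCat.of (Polynomial B) M) (n + 1) := by
  let _ : Module B M := Module.compHom M (Polynomial.C : B →+* Polynomial B)
  have : IsScalarTower B (Polynomial B) M := ⟨fun b p m => by
    rw [Polynomial.smul_eq_C_mul, mul_smul]; rfl⟩
  have h := hasProjectiveDimensionLE_baseChange (R := Polynomial B) n M (hB M)
  exact hasProjectiveDimensionLE_of_exact subX_injective actionMap_surjective
    exact_subX_actionMap h (hasProjectiveDimensionLT_of_ge _ (n + 1) _ (by omega))

theorem hasProjectiveDimensionLE_of_ringEquiv {A B : Type u} [CommRing A] [CommRing B]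
    (e : A ≃+* B) {n : ℕ} (hA : ∀ (M : Type u) [AddCommGroup M] [Module A M],
      HasProjectiveDimensionLE (ModuleCat.of A M) n)
    (M : Type u) [AddCommGroup M] [Module B M] :
    HasProjectiveDimensionLE (ModuleCat.of B M) n := by
  let _ : Module A M := Module.compHom M e.toRingHom
  have := RingHomInvPair.of_ringEquiv e
  have := RingHomInvPair.of_ringEquiv e.symm
  let e' : M ≃ₛₗ[RingHomClass.toRingHom e] M :=
    { AddEquiv.refl M with map_smul' := fun a m => rfl }
  have := hA M
  exact ModuleCat.hasProjectiveDimensionLE_of_semiLinearEquiv e (M := ModuleCat.of A M)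
    (N := ModuleCat.of B M) e' n

/-- Hilbert's syzygy theorem: polynomial rings in `t` variables have global dimension at
most `t`. -/
theorem hasProjectiveDimensionLE_mvPolynomial (k : Type u) [Field k] (t : ℕ) :
    ∀ (M : Type u) [AddCommGroup M] [Module (MvPolynomial (Fin t) k) M],
      HasProjectiveDimensionLE (ModuleCat.of (MvPolynomial (Fin t) k) M) t := by
  induction t with
  | zero =>
    exact hasProjectiveDimensionLE_of_ringEquiv (isEmptyRingEquiv k (Fin 0)).symm
      fun M _ _ => hasProjectiveDimensionLE_of_projective k M 0
  | succ t ih =>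
    exact hasProjectiveDimensionLE_of_ringEquiv (finSuccEquiv k t).symm.toRingEquiv
      (hasProjectiveDimensionLE_polynomial ih)

/-- For a flat algebra `R`, the extension of the ideal `I` is isomorphic to `R ⊗ I`. -/
theorem hasProjectiveDimensionLE_ideal_map {A R : Type u} [CommRing A] [CommRing R] [Algebra A R]
    [Module.Flat A R] {n : ℕ} (I : Ideal A) (hI : HasProjectiveDimensionLE (ModuleCat.of A I) n) :
    HasProjectiveDimensionLE (ModuleCat.of R (I.map (algebraMap A R))) n := by
  let θ : R ⊗[A] I →ₗ[R] R :=
    (AlgebraTensorModule.rid A R R).toLinearMap ∘ₗ I.subtype.baseChange R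
  have hθ : ∀ (r : R) (a : I), θ (r ⊗ₜ a) = algebraMap A R a * r := fun r a => by
    simp [θ, Algebra.smul_def]
  have hinj : Function.Injective θ := (AlgebraTensorModule.rid A R R).injective.comp
    (Module.Flat.lTensor_preserves_injective_linearMap _ I.injective_subtype)
  have hrange : LinearMap.range θ = I.map (algebraMap A R) := by
    refine le_antisymm ?_ (Ideal.span_le.2 ?_)
    · rintro _ ⟨z, rfl⟩
      induction z with
      | zero => simp
      | tmul r a => rw [hθ]; exact Ideal.mul_mem_right _ _ (Ideal.mem_map_of_mem _ a.2)
      | add x y hx hy => rw [map_add]; exact add_mem hx hy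
    · rintro _ ⟨a, ha, rfl⟩
      exact ⟨1 ⊗ₜ ⟨a, ha⟩, by rw [hθ, mul_one]⟩
  have := hasProjectiveDimensionLE_baseChange (R := R) n I hI
  exact ModuleCat.hasProjectiveDimensionLE_of_linearEquiv (M := ModuleCat.of R (R ⊗[A] I))
    (N := ModuleCat.of R (I.map (algebraMap A R)))
    ((LinearEquiv.ofInjective θ hinj).trans (LinearEquiv.ofEq _ _ hrange)) n

/-- An ideal generated by elements of the subalgebra generated by a homogeneous regular sequence is
extended from a polynomial ring, over which the ambient ring is free. -/
theorem hasProjectiveDimensionLE_of_mem_adjoin {k : Type u} [Field k] {n t : ℕ}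
    {g : ℕ → MvPolynomial (Fin n) k} {e : ℕ → ℕ} (hg : ∀ j < t, (g j).IsHomogeneous (e j))
    (he : ∀ j < t, 0 < e j) (hreg : RegularMod ⊥ g t) {r : ℕ} {f : Fin r → MvPolynomial (Fin n) k}
    (hf : ∀ i, f i ∈ Algebra.adjoin k (Set.range fun j : Fin t => g j)) :
    HasProjectiveDimensionLE
      (ModuleCat.of (MvPolynomial (Fin n) k) (Ideal.span (Set.range f))) t := by
  have hbot : HasComponents (⊥ : Ideal (MvPolynomial (Fin n) k)) := by
    rw [← linearIdeal_bot]
    exact hasComponents_linearIdeal ⊥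
  obtain ⟨ι, b, hspan, hinj⟩ := exists_basis_mod hbot hg he hreg
  simp only [Algebra.adjoin_range_eq_range_aeval] at hf
  choose F hF using hf
  let _ : Algebra (MvPolynomial (Fin t) k) (MvPolynomial (Fin n) k) :=
    (aeval fun j : Fin t => g j).toRingHom.toAlgebra
  have hcomb : ∀ p, polyCombination k t g b p =
      Finsupp.linearCombination (MvPolynomial (Fin t) k) b p := fun p => by
    rw [polyCombination_apply, Finsupp.linearCombination_apply]
    rfl
  have hbij : Function.Bijective (Finsupp.linearCombination (MvPolynomial (Fin t) k) b) := by
    constructor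
    · rw [injective_iff_map_eq_zero]
      exact fun p hp => hinj p (by rw [hcomb, hp]; exact zero_mem _)
    · intro x
      obtain ⟨p, hp⟩ := hspan x
      exact ⟨p, by rw [← hcomb]; exact (sub_eq_zero.1 hp).symm⟩
  have : Module.Free (MvPolynomial (Fin t) k) (MvPolynomial (Fin n) k) :=
    Module.Free.of_equiv (LinearEquiv.ofBijective _ hbij)
  have hmap : Ideal.span (Set.range f) = (Ideal.span (Set.range F)).map
      (algebraMap (MvPolynomial (Fin t) k) (MvPolynomial (Fin n) k)) := by
    rw [Ideal.map_span, ← Set.range_comp]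
    congr 2
    funext i
    exact (hF i).symm
  rw [hmap]
  exact hasProjectiveDimensionLE_ideal_map _ (hasProjectiveDimensionLE_mvPolynomial k t _)

end ProjectiveDimension

/-! ### Regular sequences as lists -/

theorem isRegular_ofFn_of_regularMod {k : Type*} [Field k] {n t : ℕ}
    {g : ℕ → MvPolynomial (Fin n) k} {e : ℕ → ℕ} (hg : ∀ j < t, (g j).IsHomogeneous (e j))
    (he : ∀ j < t, 0 < e j) (hreg : RegularMod ⊥ g t) :
    RingTheory.Sequence.IsRegular (MvPolynomial (Fin n) k) (List.ofFn fun j : Fin t => g j) := by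
  have hlist : ∀ i ≤ t, Ideal.ofList ((List.ofFn fun j : Fin t => g j).take i) =
      partialIdeal ⊥ g i := by
    intro i hi
    rw [partialIdeal, bot_sup_eq, Ideal.ofList]
    congr 1
    ext x
    simp only [Set.mem_ofPred_eq, List.mem_take_iff_getElem, List.getElem_ofFn, Set.mem_image,
      Set.mem_Iio, List.length_ofFn, lt_min_iff]
    constructor
    · rintro ⟨j, hj, rfl⟩
      exact ⟨j, hj.1, rfl⟩
    · rintro ⟨j, hj, rfl⟩
      exact ⟨j, ⟨hj, hj.trans_le hi⟩, rfl⟩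
  rw [RingTheory.Sequence.isRegular_iff, RingTheory.Sequence.isWeaklyRegular_iff]
  constructor
  · intro i hi
    have hi' : i < t := by simpa using hi
    rw [isSMulRegular_quotient_iff_mem_of_smul_mem, hlist i hi'.le]
    intro u hu
    simp only [List.getElem_ofFn, smul_eq_mul, Ideal.mul_top] at hu ⊢
    exact hreg i hi' u hu
  · have h1 := hlist t le_rfl
    rw [List.take_of_length_le (by simp)] at h1
    rw [h1, smul_eq_mul, Ideal.mul_top, ← linearIdeal_bot]
    exact (partialIdeal_ne_top hg he).symm

/-! ### Bounds independent of the number of variables -/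

theorem mainTheorem2 (r : ℕ) (d : Fin r → ℕ) (hd : ∀ i, 0 < d i) :
    ∃ s : ℕ, ∀ (k : Type u) [Field k] [PerfectField k] (n : ℕ)
      (f : Fin r → MvPolynomial (Fin n) k), (∀ i, (f i).IsHomogeneous (d i)) →
      (∃ t : ℕ, t ≤ s ∧ ∃ g : Fin t → MvPolynomial (Fin n) k,
        RingTheory.Sequence.IsRegular (MvPolynomial (Fin n) k) (List.ofFn g) ∧
        (∀ j, ∃ e : ℕ, e ≤ Finset.univ.sup d ∧ (g j).IsHomogeneous e) ∧
        ∀ i, f i ∈ Algebra.adjoin k (Set.range g)) ∧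
      CategoryTheory.projectiveDimension
        (ModuleCat.of (MvPolynomial (Fin n) k) (Ideal.span (Set.range f))) ≤ (s : WithBot ℕ∞) := by
  obtain ⟨s, hs⟩ := exists_small_subalgebra.{u} r d
  refine ⟨s, fun k _ _ n f hf => ?_⟩
  obtain ⟨t, ht, g, e, hg, he, hed, hreg, hfg⟩ := hs k n f hf
  refine ⟨⟨t, ht, fun j => g j, isRegular_ofFn_of_regularMod hg he hreg,
    fun j => ⟨e j, hed j j.2, hg j j.2⟩, hfg⟩, ?_⟩
  rw [CategoryTheory.projectiveDimension_le_iff]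
  have := hasProjectiveDimensionLE_of_mem_adjoin hg he hreg hfg
  exact CategoryTheory.hasProjectiveDimensionLT_of_ge _ (t + 1) _ (by omega)
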